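/- Let $d\ge 2$ and let $\mathbb T$ be the infinite $(d+1)$-regular tree with root $o$ and a fixed neighbour $\bar o$ of $o$; let $\mathbb T^+$ be the set of $x\in\mathbb T$ such that $\bar o$ does not lie on the geodesic from $o$ to $x$. Let $P$ be the law on $\mathbb R^{\mathbb T}$ of the Gaussian free field $\phi=(\phi_x)_{x\in\mathbb T}$, the centred Gaussian process with covariance $E[\phi_x\phi_y]=g(x,y)=\mathbb E_x\big[\sum_{k\ge 0}1_{X_k=y}\big]$, where $(X_k)$ is simple random walk on $\mathbb T$ (so $g(o,o)=\frac{d}{d-1}$). For $a\in\mathbb R$ let $P_a=P[\,\cdot\mid\phi_o=a]$, realised as the law of the field defined by $\phi_o=a$ and $\phi_x=\frac1d\phi_{\bar x}+Y_x$ for $x\ne o$, where $\bar x$ is the direct ancestor of $x$ and the $Y_x$ are independent $\mathcal N(0,\frac{d+1}{d})$ variables. For $h\in\mathbb R$ let $\mathcal C_o^h$ be the connected component of $o$ in $\{x\in\mathbb T:\phi_x\ge h\}$ (empty if $\phi_o<h$), and put $$h^*=\inf\{h\in\mathbb R: P[|\mathcal C_o^h|=\infty]=0\},\qquad \eta(h,a)=P_a[|\mathcal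 C_o^h|=\infty],\qquad \eta^+(h,a)=P_a[|\mathcal C_o^h\cap\mathbb T^+|=\infty].$$ Then for every $a\in\mathbb R$ the functions $h\mapsto\eta(h,a)$ and $h\mapsto\eta^+(h,a)$ are continuous at every $h\in\mathbb R$ with $h\neq a$ (in particular at $h=h^*$ if $a \ne h^*$), and they are left-continuous at $h=a$. If moreover $a\ge h^*$, they are continuous on all of $\mathbb R$. -/

import Mathlib

open Set Filter Topology MeasureTheory ProbabilityTheory
open scoped NNReal ENNReal

noncomputable section

namespace TreeGFF

variable {V : Type*}

/-! ### Simple random walk and Gaussian free field -/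

open Classical in
/-- `srwProb G k x y` is the probability that simple random walk on `G` started at `x` is at `y`
after `k` steps (decomposition over the first step, uniform among the neighbours). -/
def srwProb (G : SimpleGraph V) [G.LocallyFinite] : ℕ → V → V → ℝ≥0∞
  | 0, x, y => if x = y then 1 else 0
  | k + 1, x, y => ∑ z ∈ G.neighborFinset x, (G.degree x : ℝ≥0∞)⁻¹ * srwProb G k z y

/-- The Green function: the expected number of visits to `y` of simple random walk started at `x`,
including time `0`. On the `(d+1)`-regular tree its diagonal value is `d/(d-1)`. -/
def green (G : SimpleGraph V) [G.LocallyFinite] (x y : V) : ℝ :=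
  (∑' k : ℕ, srwProb G k x y).toReal

/-- `P` is the law on `V → ℝ` of the Gaussian free field on `G`: under `P` the coordinates form a
centred Gaussian process whose covariance is the Green function. -/
structure IsGFFLaw (G : SimpleGraph V) [G.LocallyFinite] (P : Measure (V → ℝ)) : Prop where
  isGaussianProcess : IsGaussianProcess (fun (x : V) (φ : V → ℝ) => φ x) P
  mean_eq_zero : ∀ x, ∫ φ, φ x ∂P = 0
  covariance_eq : ∀ x y, ∫ φ, φ x * φ y ∂P = green G x y

/-! ### The field conditioned on its value at the root -/

/-- The value at the starting vertex of a walk `x = x₀, x₁, …, xₙ = o`, if the value at the final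
vertex `o` is `a` and if each value is `1/d` times the value at the next vertex plus the noise
at the vertex itself. -/
def fieldAlong {G : SimpleGraph V} (d : ℕ) (a : ℝ) (Y : V → ℝ) : {x o : V} → G.Walk x o → ℝ
  | _, _, .nil => a
  | x, _, .cons _ p => (1 / (d : ℝ)) * fieldAlong d a Y p + Y x

/-- The path from `x` to `o` in a tree. -/
def geodesic {G : SimpleGraph V} (hG : G.IsTree) (o x : V) : G.Walk x o :=
  (hG.existsUnique_path x o).choose

/-- The field on the tree started from `a` at the root `o` and driven by the noise `Y`: it is `a`
at `o`, and its value at `x ≠ o` is `1/d` times its value at the direct ancestor of `x`, plus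
`Y x`. -/
def branchingField {G : SimpleGraph V} (hG : G.IsTree) (d : ℕ) (o : V) (a : ℝ) (Y : V → ℝ) :
    V → ℝ :=
  fun x => fieldAlong d a Y (geodesic hG o x)

theorem measurable_fieldAlong {G : SimpleGraph V} (d : ℕ) (a : ℝ) {x o : V} (p : G.Walk x o) :
    Measurable (fun Y : V → ℝ => fieldAlong d a Y p) := by
  induction p with
  | nil => simp only [fieldAlong]; exact measurable_const
  | cons h p ih =>
    simp only [fieldAlong]
    exact (ih.const_mul _).add (measurable_pi_apply _)

theorem measurable_branchingField {G : SimpleGraph V} (hG : G.IsTree) (d : ℕ) (o : V) (a : ℝ) :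
    Measurable (branchingField hG d o a) :=
  measurable_pi_lambda _ fun _ => measurable_fieldAlong d a _

/-- The conditional law `P_a = P[ · | φ_o = a]` of the Gaussian free field on the `(d+1)`-regular
tree, in its explicit construction: the law of the branching field started from `a` and driven by
independent centred Gaussian variables of variance `(d+1)/d`. -/
def condLaw {G : SimpleGraph V} (hG : G.IsTree) (d : ℕ) (o : V) (a : ℝ) : Measure (V → ℝ) :=
  (Measure.infinitePi fun _ : V => gaussianReal 0 (((d : ℝ≥0) + 1) / d)).map
    (branchingField hG d o a)

instance {G : SimpleGraph V} (hG : G.IsTree) (d : ℕ) (o : V) (a : ℝ) :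
    IsProbabilityMeasure (condLaw hG d o a) :=
  Measure.isProbabilityMeasure_map (measurable_branchingField hG d o a).aemeasurable

/-! ### Level-set percolation -/

/-- The connected component of `o` in the level set `{x | h ≤ φ x}` (empty if `φ o < h`). -/
def cluster (G : SimpleGraph V) (o : V) (h : ℝ) (φ : V → ℝ) : Set V :=
  {y | ∃ p : G.Walk o y, ∀ z ∈ p.support, h ≤ φ z}

/-- The forward tree: the vertices `x` such that `obar` is not on the path from `o` to `x`. -/
def forwardTree {G : SimpleGraph V} (hG : G.IsTree) (o obar : V) : Set V :=
  {x | obar ∉ (geodesic hG o x).support}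

/-- The critical height of level-set percolation for a field with law `P`. -/
def hStar (G : SimpleGraph V) (P : Measure (V → ℝ)) (o : V) : ℝ :=
  sInf {h : ℝ | P {φ | (cluster G o h φ).Infinite} = 0}

/-- The percolation probability `η(h, a) = P_a[|C_o^h| = ∞]`. -/
def eta {G : SimpleGraph V} (hG : G.IsTree) (d : ℕ) (o : V) (h a : ℝ) : ℝ :=
  (condLaw hG d o a).real {φ | (cluster G o h φ).Infinite}

/-- The forward percolation probability `η⁺(h, a) = P_a[|C_o^h ∩ T⁺| = ∞]`. -/
def etaPlus {G : SimpleGraph V} (hG : G.IsTree) (d : ℕ) (o obar : V) (h a : ℝ) : ℝ :=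
  (condLaw hG d o a).real {φ | (cluster G o h φ ∩ forwardTree hG o obar).Infinite}

end TreeGFF

end

/-!
The field on the tree is a branching Markov chain: given the value `b` at a vertex, the values at
its children are independent, each distributed as `b / d + N(0, (d+1)/d)`. Let `K` (`transition`) be
the operator averaging over this step. The probability `g_h b` (`survival`) that the level set
above `h` contains arbitrarily long lines of descent from a vertex with value `b` is the largest
solution with values in `[0, 1]` of

  `g b = 1 - (1 - K g b) ^ d` for `b ≥ h`,  `g b = 0` for `b < h`   (`survival_eq_step`).

By local finiteness and by independence along the tree, `η⁺(h, a)` equals `1 - (1 - K g_h a) ^ d`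
for `h ≤ a` and `0` for `h > a`, and `η(h, a)` is given by the same formula with exponent `d + 1`
(`condLaw_real_infinite_cluster`). Everything follows once `h ↦ K g_h a` is known to be continuous
(`continuous_transition_survival`), and to vanish at `h = a` if `a ≥ h*`
(`survival_eq_zero_of_hStar_le`).

For the continuity, monotone limits of `g_{h'}` as `h' → h` from either side satisfy the recursion
at `h`, up to the value at the single point `h`, which `K` does not see. The limit from the left
lies above `g_h`, hence equals it by maximality. For the limit `f` from the right, two facts are
needed.

* If `g_h ≠ 0`, then `g_{h'} ≠ 0` for some `h' > h` (`exists_gt_survival_pos`): a small multiple of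
  `g_h`, cut off at `h'`, is a subsolution of the recursion at `h'`. The cut-off costs a term linear
  in `h' - h`, uniformly in the value at the vertex, while the strict concavity of
  `t ↦ 1 - (1 - t) ^ d` gains a term bounded below, because `K g_h` is monotone and positive.
  So `f ≠ 0`; the same fact shows that there is no survival at the critical height.
* A nonzero solution `f ≤ g_h` equals `g_h` (`eq_survival_of_pos`): the operator `K` is symmetric in
  `L²` of its stationary law `N(0, d/(d-1))`, so the integral of `K f · g_h - K g_h · f` vanishes,
  whereas strict concavity makes the integrand negative wherever `K f < K g_h`.

To connect `h*` with `g_h`, the Green function of the `(d+1)`-regular tree is computed to be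
`d/(d-1) * d ^ (-dist)` (`green_eq`). Consequently the innovations `φ x - φ (parent x) / d` of
the free field are uncorrelated, hence independent, and the free field percolates at height `h` with
positive probability if and only if `g_h ≠ 0` (`measure_infinite_cluster_eq_zero_iff`).
Finally `g_h = 0` for large `h` (`exists_survival_eq_zero`), so the set whose infimum is `h*` is not
empty. -/

noncomputable section

namespace TreeGFF

/-! ### The transition operator of the field along a line of descent -/

/-- The law `N(0, (d+1)/d)` of the noise at a single vertex. -/
def noiseLaw (d : ℕ) : Measure ℝ := gaussianReal 0 (((d : ℝ≥0) + 1) / d)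

instance (d : ℕ) : IsProbabilityMeasure (noiseLaw d) := by
  unfold noiseLaw; infer_instance

/-- The transition operator of the field from a vertex to one of its children: the value `a` is
replaced by `a / d + Y` with `Y` distributed as the noise. -/
def transition (d : ℕ) (u : ℝ → ℝ) (a : ℝ) : ℝ := ∫ y, u ((1 / (d : ℝ)) * a + y) ∂noiseLaw d

/-- The class of functions of the value at a vertex in which survival probabilities live:
monotone with values in `[0, 1]`. -/
structure IsProfile (u : ℝ → ℝ) : Prop where
  mono : Monotone u
  nonneg : ∀ b, 0 ≤ u b
  le_one : ∀ b, u b ≤ 1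

lemma IsProfile.measurable {u : ℝ → ℝ} (hu : IsProfile u) : Measurable u := hu.mono.measurable

lemma noiseVar_ne_zero {d : ℕ} (hd : 2 ≤ d) : ((d : ℝ≥0) + 1) / d ≠ 0 := by
  have : (d : ℝ≥0) ≠ 0 := by exact_mod_cast (by omega : d ≠ 0)
  positivity

lemma IsProfile.integrable_shift {d : ℕ} {u : ℝ → ℝ} (hu : IsProfile u) (c : ℝ) :
    Integrable (fun y => u (c + y)) (noiseLaw d) :=
  Integrable.of_bound (hu.measurable.comp (measurable_const_add c)).aestronglyMeasurable 1
    (ae_of_all _ fun y => by rw [Real.norm_of_nonneg (hu.nonneg _)]; exact hu.le_one _)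

lemma transition_mono {d : ℕ} {u v : ℝ → ℝ} (hu : IsProfile u) (hv : IsProfile v)
    (huv : ∀ b, u b ≤ v b) (a : ℝ) : transition d u a ≤ transition d v a :=
  integral_mono (hu.integrable_shift _) (hv.integrable_shift _) fun _ => huv _

lemma IsProfile.transition {d : ℕ} {u : ℝ → ℝ} (hu : IsProfile u) :
    IsProfile (transition d u) where
  mono a b hab := integral_mono (hu.integrable_shift _) (hu.integrable_shift _) fun _ =>
    hu.mono (by gcongr)
  nonneg a := integral_nonneg fun _ => hu.nonneg _
  le_one a := by
    refine (integral_mono (hu.integrable_shift _) (integrable_const 1)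
      fun _ => hu.le_one _).trans ?_
    simp

/-- Dominated convergence for the transition operator; the noise has no atoms, so that pointwise
convergence is needed only off one point. -/
lemma tendsto_transition {ι : Type*} {l : Filter ι} [l.IsCountablyGenerated] {d : ℕ} (hd : 2 ≤ d)
    {u : ι → ℝ → ℝ} {v : ℝ → ℝ} (hu : ∀ i, IsProfile (u i)) (h : ℝ)
    (huv : ∀ b, b ≠ h → Tendsto (fun i => u i b) l (𝓝 (v b))) (a : ℝ) :
    Tendsto (fun i => transition d (u i) a) l (𝓝 (transition d v a)) := by
  refine tendsto_integral_filter_of_dominated_convergence (fun _ => 1)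
    (.of_forall fun i => ((hu i).integrable_shift _).aestronglyMeasurable)
    (.of_forall fun i => ae_of_all _ fun y => ?_) (integrable_const 1) ?_
  · rw [Real.norm_of_nonneg ((hu i).nonneg _)]; exact (hu i).le_one _
  · have := nullSingletonClass_gaussianReal (μ := 0) (noiseVar_ne_zero hd)
    have hn : noiseLaw d {h - (1 / (d : ℝ)) * a} = 0 := by
      unfold noiseLaw; exact measure_singleton _
    filter_upwards [compl_mem_ae_iff.2 hn] with y hy
    refine huv _ fun h' => hy ?_
    simp only [mem_singleton_iff]; linarith

/-! ### The survival recursion -/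

open Classical in
/-- The recursion for survival probabilities: a vertex whose value is at least `h` survives if one
of its `d` children does. -/
def survivalStep (d : ℕ) (h : ℝ) (u : ℝ → ℝ) (b : ℝ) : ℝ :=
  if h ≤ b then 1 - (1 - transition d u b) ^ d else 0

open Classical in
/-- The probability that the level set above `h` contains a line of descent of `n` generations
below a vertex with value `b`. -/
def survivalUpTo (d : ℕ) (h : ℝ) : ℕ → ℝ → ℝ
  | 0 => fun b => if h ≤ b then 1 else 0
  | n + 1 => survivalStep d h (survivalUpTo d h n)

/-- The probability that the level set above `h` contains lines of descent of any length below
a vertex with value `b`. -/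
def survival (d : ℕ) (h b : ℝ) : ℝ := ⨅ n, survivalUpTo d h n b

lemma one_sub_pow_mono {m : ℕ} {s t : ℝ} (ht : t ≤ 1) (hst : s ≤ t) :
    1 - (1 - s) ^ m ≤ 1 - (1 - t) ^ m := by
  have := pow_le_pow_left₀ (by linarith : 0 ≤ 1 - t) (by linarith : 1 - t ≤ 1 - s) m
  linarith

lemma one_sub_pow_nonneg {m : ℕ} {s : ℝ} (h0 : 0 ≤ s) (h1 : s ≤ 1) : 0 ≤ 1 - (1 - s) ^ m := by
  have := pow_le_one₀ (n := m) (by linarith : 0 ≤ 1 - s) (by linarith)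
  linarith

lemma one_sub_pow_le_one {m : ℕ} {s : ℝ} (h1 : s ≤ 1) : 1 - (1 - s) ^ m ≤ 1 := by
  have := pow_nonneg (by linarith : 0 ≤ 1 - s) m
  linarith

lemma survivalStep_mono {d : ℕ} {u v : ℝ → ℝ} (hu : IsProfile u) (hv : IsProfile v)
    (huv : ∀ b, u b ≤ v b) (h b : ℝ) : survivalStep d h u b ≤ survivalStep d h v b := by
  unfold survivalStep
  split_ifs
  · exact one_sub_pow_mono (hv.transition.le_one _) (transition_mono hu hv huv b)
  · exact le_rfl

lemma IsProfile.survivalStep {d : ℕ} {u : ℝ → ℝ} (hu : IsProfile u) (h : ℝ) :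
    IsProfile (survivalStep d h u) where
  nonneg b := by
    unfold TreeGFF.survivalStep
    split_ifs
    · exact one_sub_pow_nonneg (hu.transition.nonneg _) (hu.transition.le_one _)
    · exact le_rfl
  le_one b := by
    unfold TreeGFF.survivalStep
    split_ifs
    · exact one_sub_pow_le_one (hu.transition.le_one _)
    · exact zero_le_one
  mono b c hbc := by
    unfold TreeGFF.survivalStep
    split_ifs with h1 h2
    · exact one_sub_pow_mono (hu.transition.le_one _) (hu.transition.mono hbc)
    · exact absurd (h1.trans hbc) h2
    · exact one_sub_pow_nonneg (hu.transition.nonneg _) (hu.transition.le_one _)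
    · exact le_rfl

lemma isProfile_survivalUpTo (d : ℕ) (h : ℝ) (n : ℕ) : IsProfile (survivalUpTo d h n) := by
  induction n with
  | zero =>
    refine ⟨fun b c hbc => ?_, fun b => ?_, fun b => ?_⟩ <;> simp only [survivalUpTo]
    · split_ifs with h1 h2
      exacts [le_rfl, absurd (h1.trans hbc) h2, zero_le_one, le_rfl]
    all_goals split_ifs <;> norm_num
  | succ n ih => exact ih.survivalStep h

lemma survivalUpTo_antitone (d : ℕ) (h b : ℝ) : Antitone (fun n => survivalUpTo d h n b) := by
  refine antitone_nat_of_succ_le fun n => ?_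
  induction n generalizing b with
  | zero =>
    simp only [survivalUpTo]
    by_cases hb : h ≤ b
    · simp only [hb, if_true]
      exact ((isProfile_survivalUpTo d h 0).survivalStep h).le_one b
    · simp [survivalStep, hb]
  | succ n ih =>
    exact survivalStep_mono (isProfile_survivalUpTo d h _) (isProfile_survivalUpTo d h _) ih h b

lemma tendsto_survivalUpTo (d : ℕ) (h b : ℝ) :
    Tendsto (fun n => survivalUpTo d h n b) atTop (𝓝 (survival d h b)) :=
  tendsto_atTop_ciInf (survivalUpTo_antitone d h b)
    ⟨0, by rintro _ ⟨n, rfl⟩; exact (isProfile_survivalUpTo d h n).nonneg b⟩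

/-- A pointwise limit of profiles is a profile. -/
lemma IsProfile.of_tendsto {ι : Type*} {l : Filter ι} [l.NeBot] {u : ι → ℝ → ℝ} {v : ℝ → ℝ}
    (hu : ∀ i, IsProfile (u i)) (huv : ∀ b, Tendsto (fun i => u i b) l (𝓝 (v b))) :
    IsProfile v where
  mono b c hbc := le_of_tendsto_of_tendsto' (huv b) (huv c) fun i => (hu i).mono hbc
  nonneg b := ge_of_tendsto' (huv b) fun i => (hu i).nonneg b
  le_one b := le_of_tendsto' (huv b) fun i => (hu i).le_one b

lemma isProfile_survival (d : ℕ) (h : ℝ) : IsProfile (survival d h) :=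
  .of_tendsto (isProfile_survivalUpTo d h) (tendsto_survivalUpTo d h)

/-- The recursion is continuous along convergent families of profiles, at fixed height. -/
lemma tendsto_one_sub_pow_transition {ι : Type*} {l : Filter ι} [l.IsCountablyGenerated] {d : ℕ}
    (hd : 2 ≤ d) (m : ℕ) {u : ι → ℝ → ℝ} {v : ℝ → ℝ} (hu : ∀ i, IsProfile (u i)) (h : ℝ)
    (huv : ∀ b, b ≠ h → Tendsto (fun i => u i b) l (𝓝 (v b))) (a : ℝ) :
    Tendsto (fun i => 1 - (1 - transition d (u i) a) ^ m) l
      (𝓝 (1 - (1 - transition d v a) ^ m)) :=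
  ((((tendsto_transition hd hu h huv a).const_sub 1).pow m).const_sub 1)

lemma tendsto_transition_survivalUpTo {d : ℕ} (hd : 2 ≤ d) (h a : ℝ) :
    Tendsto (fun n => transition d (survivalUpTo d h n) a) atTop
      (𝓝 (transition d (survival d h) a)) :=
  tendsto_transition hd (isProfile_survivalUpTo d h) h
    (fun b _ => tendsto_survivalUpTo d h b) a

lemma survival_eq_step {d : ℕ} (hd : 2 ≤ d) (h b : ℝ) :
    survival d h b = survivalStep d h (survival d h) b := by
  refine tendsto_nhds_unique ((tendsto_add_atTop_iff_nat 1).2 (tendsto_survivalUpTo d h b)) ?_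
  simp only [survivalUpTo, survivalStep]
  split_ifs
  · exact (((tendsto_transition_survivalUpTo hd h b).const_sub 1).pow d).const_sub 1
  · exact tendsto_const_nhds

lemma survival_of_le {d : ℕ} (hd : 2 ≤ d) {h b : ℝ} (hb : h ≤ b) :
    survival d h b = 1 - (1 - transition d (survival d h) b) ^ d := by
  rw [survival_eq_step hd, survivalStep, if_pos hb]

lemma survival_of_lt {d : ℕ} (hd : 2 ≤ d) {h b : ℝ} (hb : b < h) : survival d h b = 0 := by
  rw [survival_eq_step hd, survivalStep, if_neg hb.not_ge]

/-- The survival probability is the largest profile satisfying the recursion; even subsolutions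
lie below it. -/
lemma le_survival {d : ℕ} {h : ℝ} {u : ℝ → ℝ} (hu : IsProfile u)
    (hs : ∀ b, u b ≤ survivalStep d h u b) (b : ℝ) : u b ≤ survival d h b := by
  refine le_ciInf fun n => ?_
  induction n generalizing b with
  | zero =>
    simp only [survivalUpTo]
    split_ifs with hb
    · exact hu.le_one b
    · simpa [survivalStep, hb] using hs b
  | succ n ih =>
    exact (hs b).trans (survivalStep_mono hu (isProfile_survivalUpTo d h n) ih h b)

lemma survival_antitone {d : ℕ} (hd : 2 ≤ d) (b : ℝ) : Antitone (fun h => survival d h b) := by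
  intro h h' hh
  refine le_survival (isProfile_survival d h') (fun c => ?_) b
  rcases lt_or_ge c h' with hc | hc
  · rw [survival_of_lt hd hc]
    exact ((isProfile_survival d h').survivalStep h).nonneg c
  · rw [survival_of_le hd hc, survivalStep, if_pos (hh.trans hc)]

/-! ### Vanishing of the survival probability at large heights -/

lemma one_sub_pow_le_mul {t : ℝ} (h1 : t ≤ 1) (d : ℕ) :
    1 - (1 - t) ^ d ≤ d * t := by
  have := one_add_mul_le_pow (a := -t) (by linarith) d
  rw [← sub_eq_add_neg] at this
  linarith

lemma noiseVar_coe {d : ℕ} : ((((d : ℝ≥0) + 1) / d : ℝ≥0) : ℝ) = ((d : ℝ) + 1) / d := by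
  push_cast; rfl

/-- At large heights an exponential function is contracted by the recursion, so that
the population dies out. -/
lemma exists_survival_eq_zero {d : ℕ} (hd : 2 ≤ d) : ∃ h, ∀ b, survival d h b = 0 := by
  set s : ℝ := ((d : ℝ) + 1) / d with hs
  have hd0 : (2 : ℝ) ≤ d := by exact_mod_cast hd
  set h : ℝ := 2 * Real.log (2 * d * Real.exp (s / 2)) with hh
  have hpos : 0 < 2 * d * Real.exp (s / 2) := by positivity
  have hh0 : 0 ≤ h := by
    refine mul_nonneg zero_le_two (Real.log_nonneg ?_)
    have : 1 ≤ Real.exp (s / 2) := Real.one_le_exp (by positivity)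
    nlinarith
  have hexp : ∀ a, ∫ y, Real.exp ((1 / (d : ℝ)) * a + y) ∂noiseLaw d
      = Real.exp ((1 / (d : ℝ)) * a) * Real.exp (s / 2) := by
    intro a
    simp only [Real.exp_add]
    rw [integral_const_mul]
    congr 1
    have := mgf_gaussianReal (p := noiseLaw d) (X := id) (μ := 0) (v := ((d : ℝ≥0) + 1) / d)
      (by simp [noiseLaw]) 1
    simp only [mgf, id, one_mul] at this
    rw [this, noiseVar_coe]
    congr 1; rw [hs]; ring
  have hint : ∀ a, Integrable (fun y => Real.exp ((1 / (d : ℝ)) * a + y)) (noiseLaw d) := by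
    intro a
    simp only [Real.exp_add]
    refine Integrable.const_mul ?_ _
    simpa [noiseLaw] using! integrable_exp_mul_gaussianReal (μ := 0) (v := ((d : ℝ≥0) + 1) / d) 1
  have key : ∀ n b, survivalUpTo d h n b ≤ Real.exp (-h) * (1 / 2) ^ n * Real.exp b := by
    intro n
    induction n with
    | zero =>
      intro b
      simp only [survivalUpTo]
      split_ifs with hb
      · rw [pow_zero, mul_one, ← Real.exp_add]; exact Real.one_le_exp (by linarith)
      · positivity
    | succ n ih =>
      intro b
      simp only [survivalUpTo, survivalStep]
      split_ifs with hb
      · have hp := isProfile_survivalUpTo d h n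
        refine (one_sub_pow_le_mul (hp.transition.le_one _) d).trans ?_
        have h1 : transition d (survivalUpTo d h n) b ≤
            Real.exp (-h) * (1 / 2) ^ n *
              (Real.exp ((1 / (d : ℝ)) * b) * Real.exp (s / 2)) := by
          rw [← hexp, ← integral_const_mul]
          exact integral_mono (hp.integrable_shift _) ((hint b).const_mul _) fun y => ih _
        -- `h` is chosen so that `d * exp (s / 2) = exp (h / 2) / 2`
        have h2 : (d : ℝ) * (Real.exp ((1 / (d : ℝ)) * b) * Real.exp (s / 2)) ≤
            1 / 2 * Real.exp b := by
          have e1 : Real.exp (h / 2) = 2 * d * Real.exp (s / 2) := by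
            rw [hh, mul_div_cancel_left₀ _ two_ne_zero, Real.exp_log hpos]
          have e2 : (d : ℝ) * (Real.exp ((1 / (d : ℝ)) * b) * Real.exp (s / 2))
              = 1 / 2 * Real.exp ((1 / (d : ℝ)) * b + h / 2) := by
            rw [Real.exp_add, e1]; ring
          rw [e2]
          gcongr
          have : (1 / (d : ℝ)) * b ≤ 1 / 2 * b := by gcongr; linarith
          linarith
        calc (d : ℝ) * transition d (survivalUpTo d h n) b
            ≤ d * (Real.exp (-h) * (1 / 2) ^ n *
              (Real.exp ((1 / (d : ℝ)) * b) * Real.exp (s / 2))) := by gcongr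
          _ = Real.exp (-h) * (1 / 2) ^ n *
              (d * (Real.exp ((1 / (d : ℝ)) * b) * Real.exp (s / 2))) := by ring
          _ ≤ Real.exp (-h) * (1 / 2) ^ n * (1 / 2 * Real.exp b) := by gcongr
          _ = _ := by ring
      · positivity
  refine ⟨h, fun b => le_antisymm ?_ ((isProfile_survival d h).nonneg b)⟩
  refine le_of_tendsto_of_tendsto' (tendsto_survivalUpTo d h b) ?_ (fun n => key n b)
  have : Tendsto (fun n : ℕ => Real.exp (-h) * (1 / 2) ^ n * Real.exp b) atTop
      (𝓝 (Real.exp (-h) * 0 * Real.exp b)) :=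
    ((tendsto_pow_atTop_nhds_zero_of_lt_one (by norm_num) (by norm_num)).const_mul _).mul_const _
  simpa using this

/-! ### Survival persists at slightly larger heights -/

lemma noiseLaw_real_Ico_le {d : ℕ} (hd : 2 ≤ d) :
    ∃ C, 0 < C ∧ ∀ x y, x ≤ y → (noiseLaw d).real (Ico x y) ≤ C * (y - x) := by
  have hv := noiseVar_ne_zero hd
  set v : ℝ≥0 := ((d : ℝ≥0) + 1) / d with hvdef
  have hC : 0 < (√(2 * Real.pi * v))⁻¹ := by
    have : (0 : ℝ) < v := by exact_mod_cast pos_iff_ne_zero.2 hv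
    positivity
  refine ⟨(√(2 * Real.pi * v))⁻¹, hC, fun x y hxy => ?_⟩
  have hle : noiseLaw d (Ico x y) ≤ ENNReal.ofReal ((√(2 * Real.pi * v))⁻¹ * (y - x)) := by
    rw [noiseLaw, gaussianReal_apply _ hv, ENNReal.ofReal_mul hC.le]
    refine (lintegral_mono (g := fun _ => ENNReal.ofReal (√(2 * Real.pi * v))⁻¹)
      fun b => ENNReal.ofReal_le_ofReal ?_).trans ?_
    · rw [gaussianPDFReal_def]
      refine mul_le_of_le_one_right hC.le (Real.exp_le_one_iff.2 ?_)
      rw [neg_div]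
      exact neg_nonpos.2 (by positivity)
    · simp
  exact ENNReal.toReal_le_of_le_ofReal (mul_nonneg hC.le (by linarith)) hle

lemma noiseLaw_real_Ici_pos {d : ℕ} (hd : 2 ≤ d) (x : ℝ) : 0 < (noiseLaw d).real (Ici x) := by
  refine ENNReal.toReal_pos (fun h0 => ?_) (measure_ne_top _ _)
  have := gaussianReal_absolutelyContinuous' 0 (noiseVar_ne_zero hd) h0
  simp at this

/-- The noise can carry any value above any other one, so a profile that is somewhere positive
is everywhere positive after one transition. -/
lemma transition_pos {d : ℕ} (hd : 2 ≤ d) {u : ℝ → ℝ} (hu : IsProfile u) {b : ℝ} (hb : 0 < u b)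
    (a : ℝ) : 0 < transition d u a := by
  have hI : Integrable ((Ici (b - (1 / (d : ℝ)) * a)).indicator fun _ => u b) (noiseLaw d) :=
    (integrable_const _).indicator measurableSet_Ici
  refine lt_of_lt_of_le ?_ (integral_mono hI (hu.integrable_shift _) fun y => ?_)
  · rw [integral_indicator_const _ measurableSet_Ici]
    exact mul_pos (noiseLaw_real_Ici_pos hd _) hb
  · simp only [indicator_apply, mem_Ici]
    split_ifs with hy
    · exact hu.mono (by linarith)
    · exact hu.nonneg _

lemma le_one_sub_pow {t : ℝ} (h0 : 0 ≤ t) (h1 : t ≤ 1) (d : ℕ) :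
    d * t - (d : ℝ) ^ 2 * t ^ 2 ≤ 1 - (1 - t) ^ d := by
  induction d with
  | zero => simp
  | succ n ih =>
    have : (1 - t) ^ n ≤ 1 - n * t + (n : ℝ) ^ 2 * t ^ 2 := by linarith
    have h2 := mul_le_mul_of_nonneg_right this (by linarith : 0 ≤ 1 - t)
    rw [pow_succ (1 - t)]
    push_cast
    have hn : (0 : ℝ) ≤ n := n.cast_nonneg
    have : 0 ≤ (n : ℝ) ^ 2 * t ^ 3 := by positivity
    have : 0 ≤ (n : ℝ) * t ^ 2 := by positivity
    nlinarith

lemma one_sub_pow_le_sub_sq {t : ℝ} (h1 : t ≤ 1) {d : ℕ} (hd : 2 ≤ d) :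
    1 - (1 - t) ^ d ≤ d * t - t ^ 2 := by
  induction d, hd using Nat.le_induction with
  | base => push_cast; nlinarith
  | succ n hn ih =>
    have : 1 - n * t + t ^ 2 ≤ (1 - t) ^ n := by linarith
    have h2 := mul_le_mul_of_nonneg_right this (by linarith : 0 ≤ 1 - t)
    rw [pow_succ (1 - t)]
    push_cast
    have hn : (1 : ℝ) ≤ n := by exact_mod_cast (by omega : 1 ≤ n)
    have : t * t ^ 2 ≤ n * t ^ 2 := by gcongr; linarith
    nlinarith

/-- The set of heights with positive survival probability is open to the right: if the population
survives at height `h`, a small multiple of its survival probability, cut off at a slightly larger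
height `h'`, is a subsolution of the recursion at `h'`. The loss caused by the cut-off is dominated
by the strict concavity of `t ↦ 1 - (1 - t) ^ d`. -/
lemma exists_gt_survival_pos {d : ℕ} (hd : 2 ≤ d) {h b : ℝ} (hb : 0 < survival d h b) :
    ∃ h' > h, ∃ b', 0 < survival d h' b' := by
  classical
  have hd0 : (2 : ℝ) ≤ d := by exact_mod_cast hd
  set g := survival d h with hg
  have hgp : IsProfile g := isProfile_survival d h
  obtain ⟨C, hC, hCb⟩ := noiseLaw_real_Ico_le hd
  -- `κ` bounds `transition d g` from below on the values `≥ h`; the width `η` of the cut-off region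
  -- and the factor `ε` make both error terms at most half of the gain `(transition d g) ^ 2`
  set κ := transition d g h with hκ
  have hκ0 : 0 < κ := transition_pos hd hgp hb h
  set η := κ ^ 2 / (2 * d * C) with hη
  have hη0 : 0 < η := by positivity
  set ε : ℝ := 1 / (2 * d ^ 2) with hε
  have hε0 : 0 < ε := by positivity
  have hε1 : ε ≤ 1 := by
    rw [hε, div_le_one (by positivity)]; nlinarith
  set h' := h + η with hh'
  set w : ℝ → ℝ := fun c => if h' ≤ c then g c else 0 with hw
  have hwp : IsProfile w := by
    refine ⟨fun x y hxy => ?_, fun x => ?_, fun x => ?_⟩ <;> simp only [hw]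
    · split_ifs with h1 h2
      exacts [hgp.mono hxy, absurd (h1.trans hxy) h2, hgp.nonneg _, le_rfl]
    · split_ifs
      exacts [hgp.nonneg _, le_rfl]
    · split_ifs
      exacts [hgp.le_one _, zero_le_one]
  have hεw : IsProfile fun c => ε * w c :=
    ⟨fun x y hxy => mul_le_mul_of_nonneg_left (hwp.mono hxy) hε0.le,
      fun x => mul_nonneg hε0.le (hwp.nonneg x),
      fun x => mul_le_one₀ hε1 (hwp.nonneg x) (hwp.le_one x)⟩
  have hcut : ∀ a, transition d g a ≤ transition d w a + C * η := by
    intro a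
    set A := Ico (h - (1 / (d : ℝ)) * a) (h' - (1 / (d : ℝ)) * a) with hA
    have hI : Integrable (A.indicator fun _ => (1 : ℝ)) (noiseLaw d) :=
      (integrable_const _).indicator measurableSet_Ico
    have h1 : transition d g a ≤ ∫ y, (w ((1 / (d : ℝ)) * a + y) +
        A.indicator (fun _ => (1 : ℝ)) y) ∂noiseLaw d := by
      refine integral_mono (hgp.integrable_shift _) ((hwp.integrable_shift _).add hI) fun y => ?_
      simp only [hw, indicator_apply, hA, mem_Ico]
      by_cases c1 : h' ≤ (1 / (d : ℝ)) * a + y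
      · rw [if_pos c1]
        exact le_add_of_nonneg_right (by split_ifs <;> norm_num)
      · rw [if_neg c1]
        by_cases c2 : h ≤ (1 / (d : ℝ)) * a + y
        · rw [if_pos ⟨by linarith, by linarith⟩, zero_add]; exact hgp.le_one _
        · rw [hg, survival_of_lt hd (not_le.1 c2)]
          exact add_nonneg le_rfl (by split_ifs <;> norm_num)
    rw [integral_add (hwp.integrable_shift _) hI, integral_indicator_const _ measurableSet_Ico]
      at h1
    have h2 := hCb (h - (1 / (d : ℝ)) * a) (h' - (1 / (d : ℝ)) * a) (by linarith)
    have h3 : h' - (1 / (d : ℝ)) * a - (h - (1 / (d : ℝ)) * a) = η := by rw [hh']; ring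
    rw [h3] at h2
    simp only [smul_eq_mul, mul_one] at h1
    unfold transition at h1 ⊢
    linarith
  have hsub : ∀ c, ε * w c ≤ survivalStep d h' (fun c => ε * w c) c := by
    intro c
    simp only [survivalStep]
    by_cases hc : h' ≤ c
    · rw [if_pos hc]
      have hlin : transition d (fun c => ε * w c) c = ε * transition d w c := by
        simp only [transition, integral_const_mul]
      have hwc : w c = g c := if_pos hc
      rw [hlin, hwc, hg, survival_of_le hd (by linarith), ← hg]
      have hs0 := (hgp.transition (d := d)).nonneg c
      have hs1 := (hgp.transition (d := d)).le_one c
      have hr0 := (hwp.transition (d := d)).nonneg c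
      have hr1 := (hwp.transition (d := d)).le_one c
      have hκs : κ ≤ transition d g c := hgp.transition.mono (by linarith)
      have hrs : transition d w c ≤ transition d g c := by
        refine transition_mono hwp hgp (fun x => ?_) c
        simp only [hw]; split_ifs
        exacts [le_rfl, hgp.nonneg x]
      have hc1 := hcut c
      set s := transition d g c
      set r := transition d w c
      have hF := le_one_sub_pow (t := ε * r) (by positivity) (mul_le_one₀ hε1 hr0 hr1) d
      have hG := one_sub_pow_le_sub_sq hs1 hd
      refine le_trans (mul_le_mul_of_nonneg_left hG hε0.le) (le_trans ?_ hF)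
      have e1 : (d : ℝ) ^ 2 * (ε * r) ^ 2 = ε * (r ^ 2 / 2) := by
        rw [hε]; field_simp
      have e2 : (d : ℝ) * (C * η) = κ ^ 2 / 2 := by rw [hη]; field_simp
      have e3 : κ ^ 2 ≤ s ^ 2 := pow_le_pow_left₀ hκ0.le hκs 2
      have e4 : r ^ 2 ≤ s ^ 2 := pow_le_pow_left₀ hr0 hrs 2
      have e5 : (d : ℝ) * s ≤ d * r + d * (C * η) := by nlinarith
      have : ε * (d * s - s ^ 2) ≤ ε * (d * r - r ^ 2 / 2) := by
        refine mul_le_mul_of_nonneg_left ?_ hε0.le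
        linarith
      rw [e1]; linarith
    · rw [if_neg hc]; simp [hw, hc]
  refine ⟨h', by linarith, max b h', lt_of_lt_of_le ?_ (le_survival hεw hsub _)⟩
  have : w (max b h') = g (max b h') := if_pos (le_max_right _ _)
  rw [this]
  exact mul_pos hε0 (hb.trans_le (hgp.mono (le_max_left _ _)))

/-! ### Reversibility of the transition operator -/

/-- The stationary law `N(0, d/(d-1))` of the transition operator, which is the law of
the free field at a single vertex. -/
def stationaryLaw (d : ℕ) : Measure ℝ := gaussianReal 0 ((d : ℝ) / (d - 1)).toNNReal

instance (d : ℕ) : IsProbabilityMeasure (stationaryLaw d) := by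
  unfold stationaryLaw; infer_instance

lemma stationaryVar_pos {d : ℕ} (hd : 2 ≤ d) : 0 < (d : ℝ) / (d - 1) := by
  have hd0 : (2 : ℝ) ≤ d := by exact_mod_cast hd
  exact div_pos (by linarith) (by linarith)

lemma stationaryVar_ne_zero {d : ℕ} (hd : 2 ≤ d) : ((d : ℝ) / (d - 1)).toNNReal ≠ 0 :=
  (Real.toNNReal_pos.2 (stationaryVar_pos hd)).ne'

/-- The density of the joint law of the values at a vertex and at one of its children, when
the value at the vertex is stationary. -/
def jointPDF (d : ℕ) (a b : ℝ) : ℝ :=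
  gaussianPDFReal 0 ((d : ℝ) / (d - 1)).toNNReal a *
    gaussianPDFReal 0 (((d : ℝ≥0) + 1) / d) (b - (1 / (d : ℝ)) * a)

lemma jointPDF_symm {d : ℕ} (hd : 2 ≤ d) (a b : ℝ) : jointPDF d a b = jointPDF d b a := by
  have hd0 : (2 : ℝ) ≤ d := by exact_mod_cast hd
  have h1 : (d : ℝ) - 1 ≠ 0 := by linarith
  have h2 : (d : ℝ) + 1 ≠ 0 := by linarith
  have h3 : (d : ℝ) ≠ 0 := by linarith
  simp only [jointPDF, gaussianPDFReal_def, noiseVar_coe,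
    Real.coe_toNNReal _ (stationaryVar_pos hd).le]
  rw [mul_mul_mul_comm, ← Real.exp_add, mul_mul_mul_comm, ← Real.exp_add]
  congr 2
  field_simp
  ring

lemma jointPDF_nonneg (d : ℕ) (a b : ℝ) : 0 ≤ jointPDF d a b :=
  mul_nonneg (gaussianPDFReal_nonneg _ _ _) (gaussianPDFReal_nonneg _ _ _)

lemma measurable_jointPDF (d : ℕ) : Measurable (fun p : ℝ × ℝ => jointPDF d p.1 p.2) := by
  unfold jointPDF
  exact ((measurable_gaussianPDFReal _ _).comp measurable_fst).mul
    ((measurable_gaussianPDFReal _ _).comp (by fun_prop))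

lemma integrable_jointPDF {d : ℕ} (hd : 2 ≤ d) :
    Integrable (fun p : ℝ × ℝ => jointPDF d p.1 p.2) := by
  rw [Measure.volume_eq_prod,
    integrable_prod_iff (measurable_jointPDF d).aestronglyMeasurable]
  refine ⟨ae_of_all _ fun a => ?_, ?_⟩
  · simp only [jointPDF]
    exact ((integrable_gaussianPDFReal _ _).comp_sub_right ((1 / (d : ℝ)) * a)).const_mul _
  · simp only [Real.norm_of_nonneg (jointPDF_nonneg d _ _)]
    simp only [jointPDF, integral_const_mul]
    have : ∀ a : ℝ, ∫ y, gaussianPDFReal 0 (((d : ℝ≥0) + 1) / d) (y - (1 / (d : ℝ)) * a) = 1 :=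
      fun a => by
        rw [integral_sub_right_eq_self (gaussianPDFReal 0 (((d : ℝ≥0) + 1) / d)),
          integral_gaussianPDFReal_eq_one _ (noiseVar_ne_zero hd)]
    simp only [this, mul_one]
    exact integrable_gaussianPDFReal _ _

lemma integral_transition_mul {d : ℕ} (hd : 2 ≤ d) (u v : ℝ → ℝ) :
    ∫ a, transition d u a * v a ∂stationaryLaw d
      = ∫ a, ∫ b, jointPDF d a b * (u b * v a) := by
  rw [stationaryLaw, integral_gaussianReal_eq_integral_smul (stationaryVar_ne_zero hd)]
  congr 1; ext a
  rw [transition, noiseLaw, integral_gaussianReal_eq_integral_smul (noiseVar_ne_zero hd)]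
  have := integral_sub_right_eq_self (μ := volume) (fun y =>
    gaussianPDFReal 0 (((d : ℝ≥0) + 1) / d) y • u ((1 / (d : ℝ)) * a + y)) ((1 / (d : ℝ)) * a)
  rw [← this, smul_eq_mul, mul_comm _ (v a), ← mul_assoc, ← integral_const_mul]
  congr 1; ext b
  simp only [jointPDF, smul_eq_mul, add_sub_cancel]
  ring

/-- The transition operator is symmetric with respect to its stationary law. -/
lemma integral_transition_mul_comm {d : ℕ} (hd : 2 ≤ d) {u v : ℝ → ℝ} (hu : IsProfile u)
    (hv : IsProfile v) :
    ∫ a, transition d u a * v a ∂stationaryLaw d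
      = ∫ a, transition d v a * u a ∂stationaryLaw d := by
  rw [integral_transition_mul hd, integral_transition_mul hd, integral_integral_swap]
  · simp only [jointPDF_symm hd, mul_comm]
  · refine (integrable_jointPDF hd).mono ?_ (ae_of_all _ fun p => ?_)
    · exact ((measurable_jointPDF d).mul ((hu.measurable.comp measurable_snd).mul
        (hv.measurable.comp measurable_fst))).aestronglyMeasurable
    · simp only [Function.uncurry, norm_mul]
      refine mul_le_of_le_one_right (norm_nonneg _) ?_
      rw [Real.norm_of_nonneg (hu.nonneg _), Real.norm_of_nonneg (hv.nonneg _)]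
      exact mul_le_one₀ (hu.le_one _) (hv.nonneg _) (hv.le_one _)

/-! ### Uniqueness of the positive solution of the recursion -/

/-- Strict concavity of `t ↦ 1 - (1 - t) ^ d` in the form used for uniqueness: its quotient by
`t` is strictly decreasing. -/
lemma mul_one_sub_pow_lt {d : ℕ} (hd : 2 ≤ d) {s t : ℝ} (hs : 0 < s) (hst : s < t) (ht : t ≤ 1) :
    s * (1 - (1 - t) ^ d) < t * (1 - (1 - s) ^ d) := by
  -- the quotient is the geometric sum in `1 - t`
  have e : ∀ x : ℝ, 1 - (1 - x) ^ d = x * ∑ i ∈ Finset.range d, (1 - x) ^ i := fun x => by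
    rw [← mul_neg_geom_sum]; ring
  have hlt : ∑ i ∈ Finset.range d, (1 - t) ^ i < ∑ i ∈ Finset.range d, (1 - s) ^ i := by
    refine Finset.sum_lt_sum (fun i _ => pow_le_pow_left₀ (by linarith) (by linarith) i)
      ⟨1, Finset.mem_range.2 (by omega), ?_⟩
    simpa using hst
  rw [e, e]
  have := mul_lt_mul_of_pos_left hlt (mul_pos hs (hs.trans hst))
  linarith

lemma transition_eq_of_eq {d : ℕ} (hd : 2 ≤ d) {u v : ℝ → ℝ} (hu : IsProfile u)
    (hv : IsProfile v) (huv : ∀ b, u b ≤ v b) {a : ℝ}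
    (ha : transition d u a = transition d v a) (b : ℝ) :
    transition d u b = transition d v b := by
  have h0 : ∀ c, transition d v c - transition d u c
      = ∫ y, (v ((1 / (d : ℝ)) * c + y) - u ((1 / (d : ℝ)) * c + y)) ∂noiseLaw d := fun c =>
    (integral_sub (hv.integrable_shift _) (hu.integrable_shift _)).symm
  have h1 := h0 a
  rw [ha, sub_self, eq_comm, integral_eq_zero_iff_of_nonneg_ae
    (ae_of_all _ fun y => sub_nonneg.2 (huv _))
    ((hv.integrable_shift _).sub (hu.integrable_shift _))] at h1
  -- pass from the noise law to Lebesgue measure, which is invariant under translation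
  have h2 : ∀ᵐ y, v ((1 / (d : ℝ)) * a + y) - u ((1 / (d : ℝ)) * a + y) = 0 :=
    (gaussianReal_absolutelyContinuous' 0 (noiseVar_ne_zero hd)).ae_le h1
  have h3 : ∀ᵐ y, v ((1 / (d : ℝ)) * b + y) - u ((1 / (d : ℝ)) * b + y) = 0 := by
    have := (measurePreserving_add_left (volume : Measure ℝ)
      ((1 / (d : ℝ)) * b - (1 / (d : ℝ)) * a)).quasiMeasurePreserving.ae h2
    filter_upwards [this] with y hy
    rw [← hy]; ring_nf
  have h4 : ∀ᵐ y ∂noiseLaw d, v ((1 / (d : ℝ)) * b + y) - u ((1 / (d : ℝ)) * b + y) = 0 :=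
    (gaussianReal_absolutelyContinuous 0 (noiseVar_ne_zero hd)).ae_le h3
  have h5 := h0 b
  rw [integral_congr_ae h4, integral_zero] at h5
  linarith

/-- The recursion has at most one nonzero solution: a nonzero profile `u` below the survival
probability `g`, satisfying the recursion off the point `h`, agrees with `g` off `h`. Indeed the
integral of `K u · g - K g · u` against the stationary law vanishes, where `K` is the transition
operator, whereas strict concavity makes the integrand negative wherever `0 < K u < K g`. -/
lemma eq_survival_of_pos {d : ℕ} (hd : 2 ≤ d) {h : ℝ} {u : ℝ → ℝ} (hu : IsProfile u)
    (hus : ∀ b, b ≠ h → u b = survivalStep d h u b) (hle : ∀ b, u b ≤ survival d h b)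
    {b₀ : ℝ} (hpos : 0 < u b₀) {b : ℝ} (hb : b ≠ h) : u b = survival d h b := by
  set g := survival d h with hg
  have hgp : IsProfile g := isProfile_survival d h
  have hint : ∀ {v w : ℝ → ℝ}, IsProfile v → IsProfile w →
      Integrable (fun a => transition d v a * w a) (stationaryLaw d) := fun {v w} hv hw =>
    Integrable.of_bound ((hv.transition.measurable.mul hw.measurable).aestronglyMeasurable) 1
      (ae_of_all _ fun a => by
        rw [Real.norm_of_nonneg (mul_nonneg (hv.transition.nonneg _) (hw.nonneg _))]
        exact mul_le_one₀ (hv.transition.le_one _) (hw.nonneg _) (hw.le_one _))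
  have hzero : ∫ a, (transition d g a * u a - transition d u a * g a) ∂stationaryLaw d = 0 := by
    rw [integral_sub (hint hgp hu) (hint hu hgp), integral_transition_mul_comm hd hgp hu, sub_self]
  have hval : ∀ a, h < a → u a = 1 - (1 - transition d u a) ^ d ∧
      g a = 1 - (1 - transition d g a) ^ d := fun a ha =>
    ⟨by rw [hus a ha.ne', survivalStep, if_pos ha.le], survival_of_le hd ha.le⟩
  have hstrict : ∀ a, h < a → transition d u a ≠ transition d g a →
      transition d u a * g a < transition d g a * u a := fun a ha hne => by
    obtain ⟨e1, e2⟩ := hval a ha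
    rw [e1, e2]
    exact mul_one_sub_pow_lt hd (transition_pos hd hu hpos a)
      (lt_of_le_of_ne (transition_mono hu hgp hle a) hne) (hgp.transition.le_one a)
  have hnn : ∀ᵐ a ∂stationaryLaw d, 0 ≤ transition d g a * u a - transition d u a * g a := by
    have := nullSingletonClass_gaussianReal (μ := 0) (stationaryVar_ne_zero hd)
    have hn : stationaryLaw d {h} = 0 := by
      unfold stationaryLaw; exact measure_singleton _
    filter_upwards [compl_mem_ae_iff.2 hn] with a ha
    rcases lt_or_gt_of_ne (show a ≠ h from ha) with ha | ha
    · have : u a = 0 := by rw [hus a ha.ne, survivalStep, if_neg ha.not_ge]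
      rw [this, hg, survival_of_lt hd ha]; simp
    · by_cases hne : transition d u a = transition d g a
      · obtain ⟨e1, e2⟩ := hval a ha
        rw [e1, e2, hne, sub_self]
      · exact sub_nonneg.2 (hstrict a ha hne).le
  rw [integral_eq_zero_iff_of_nonneg_ae hnn ((hint hgp hu).sub (hint hu hgp))] at hzero
  have hex : ∃ a, h < a ∧ transition d u a = transition d g a := by
    by_contra! hcon
    have hz : stationaryLaw d (Ioi h) = 0 := by
      refine measure_mono_null (fun a ha => ?_) (ae_iff.1 hzero)
      exact (sub_pos.2 (hstrict a ha (hcon a ha))).ne'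
    have := gaussianReal_absolutelyContinuous' 0 (stationaryVar_ne_zero hd) hz
    simp at this
  obtain ⟨a, -, ha⟩ := hex
  rcases lt_or_gt_of_ne hb with hb | hb
  · rw [hus b hb.ne, survivalStep, if_neg hb.not_ge, hg, survival_of_lt hd hb]
  · obtain ⟨e1, e2⟩ := hval b hb
    rw [e1, e2, transition_eq_of_eq hd hu hgp hle ha b]

/-! ### Continuity of the survival probability in the height -/

/-- As the height increases to `h`, the survival probabilities decrease to a solution of
the recursion at `h`, which is at most the largest solution. -/
lemma tendsto_survival_left {d : ℕ} (hd : 2 ≤ d) (h b : ℝ) :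
    Tendsto (fun h' => survival d h' b) (𝓝[<] h) (𝓝 (survival d h b)) := by
  set f : ℝ → ℝ := fun c => sInf ((fun h' => survival d h' c) '' Iio h) with hf
  have hlim : ∀ c, Tendsto (fun h' => survival d h' c) (𝓝[<] h) (𝓝 (f c)) := fun c =>
    (survival_antitone hd c).tendsto_nhdsLT h
  have hfp : IsProfile f := .of_tendsto (isProfile_survival d) hlim
  have hle : ∀ c, f c ≤ survival d h c := by
    refine le_survival hfp fun c => ?_
    rcases lt_or_ge c h with hc | hc
    · have : f c = 0 := tendsto_nhds_unique (hlim c) (tendsto_const_nhds.congr' (by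
        filter_upwards [Ioo_mem_nhdsLT hc] with h' hh'
        exact (survival_of_lt hd hh'.1).symm))
      rw [this]; exact (hfp.survivalStep h).nonneg c
    · rw [survivalStep, if_pos hc]
      refine (tendsto_nhds_unique (hlim c) ?_).le
      refine (tendsto_one_sub_pow_transition hd d (isProfile_survival d) h
        (fun x _ => hlim x) c).congr' ?_
      filter_upwards [self_mem_nhdsWithin] with h' hh'
      exact (survival_of_le hd ((mem_Iio.1 hh').le.trans hc)).symm
  have heq : f b = survival d h b := le_antisymm (hle b)
    (ge_of_tendsto (hlim b) (by
      filter_upwards [self_mem_nhdsWithin] with h' hh'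
      exact survival_antitone hd b (mem_Iio.1 hh').le))
  exact heq ▸ hlim b

/-- As the height decreases to `h`, the survival probabilities increase to a solution of
the recursion at `h`. It is nonzero if the survival probability at `h` is, hence agrees with it. -/
lemma tendsto_survival_right {d : ℕ} (hd : 2 ≤ d) {h b : ℝ} (hb : b ≠ h) :
    Tendsto (fun h' => survival d h' b) (𝓝[>] h) (𝓝 (survival d h b)) := by
  set f : ℝ → ℝ := fun c => sSup ((fun h' => survival d h' c) '' Ioi h) with hf
  have hlim : ∀ c, Tendsto (fun h' => survival d h' c) (𝓝[>] h) (𝓝 (f c)) := fun c =>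
    (survival_antitone hd c).tendsto_nhdsGT h
  have hfp : IsProfile f := .of_tendsto (isProfile_survival d) hlim
  have hle : ∀ c, f c ≤ survival d h c := fun c => le_of_tendsto (hlim c) (by
    filter_upwards [self_mem_nhdsWithin] with h' hh'
    exact survival_antitone hd c (mem_Ioi.1 hh').le)
  have hge : ∀ h' > h, ∀ c, survival d h' c ≤ f c := fun h' hh' c => ge_of_tendsto (hlim c) (by
    filter_upwards [Ioo_mem_nhdsGT hh'] with h'' hh''
    exact survival_antitone hd c hh''.2.le)
  suffices heq : f b = survival d h b from heq ▸ hlim b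
  by_cases hz : ∃ c, 0 < survival d h c
  · obtain ⟨c, hc⟩ := hz
    obtain ⟨h', hh', c', hc'⟩ := exists_gt_survival_pos hd hc
    refine eq_survival_of_pos hd hfp (fun x hx => ?_) hle (hc'.trans_le (hge h' hh' c')) hb
    rcases lt_or_gt_of_ne hx with hx | hx
    · rw [survivalStep, if_neg hx.not_ge]
      exact le_antisymm ((hle x).trans (survival_of_lt hd hx).le) (hfp.nonneg x)
    · rw [survivalStep, if_pos hx.le]
      refine tendsto_nhds_unique (hlim x) ?_
      refine (tendsto_one_sub_pow_transition hd d (isProfile_survival d) h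
        (fun y _ => hlim y) x).congr' ?_
      filter_upwards [Ioo_mem_nhdsGT hx] with h' hh'
      exact (survival_of_le hd hh'.2.le).symm
  · push Not at hz
    exact le_antisymm (hle b) ((hz b).trans (hfp.nonneg b))

/-- The possible jump of the survival probability at `h = b` is not seen by the noise. -/
lemma continuous_transition_survival {d : ℕ} (hd : 2 ≤ d) (a : ℝ) :
    Continuous (fun h => transition d (survival d h) a) := by
  refine continuous_iff_continuousAt.2 fun h => ?_
  refine tendsto_transition hd (isProfile_survival d) h (fun b hb => ?_) a
  exact (continuousAt_iff_continuous_left'_right' (f := fun h' => survival d h' b)).2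
    ⟨tendsto_survival_left hd h b, tendsto_survival_right hd hb⟩

lemma transition_survival_eq_zero {d : ℕ} {h : ℝ} (h0 : ∀ b, survival d h b = 0) (a : ℝ) :
    transition d (survival d h) a = 0 := by
  simp [transition, h0]

/-- A population that dies out at all heights above `h` dies out at `h`. This excludes survival at
the critical height. -/
lemma survival_eq_zero_of_forall_gt {d : ℕ} (hd : 2 ≤ d) {h : ℝ}
    (h0 : ∀ h' > h, ∀ b, survival d h' b = 0) (b : ℝ) : survival d h b = 0 := by
  by_contra hne
  obtain ⟨h', hh', b', hb'⟩ := exists_gt_survival_pos hd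
    (lt_of_le_of_ne ((isProfile_survival d h).nonneg b) (Ne.symm hne))
  exact hb'.ne' (h0 h' hh' b')

/-! ### Parents and children in a rooted tree -/

section Tree

variable {V : Type*} {G : SimpleGraph V} (hG : G.IsTree) (o : V)

lemma geodesic_isPath (x : V) : (geodesic hG o x).IsPath :=
  (hG.existsUnique_path x o).choose_spec.1

variable {o} in
lemma eq_geodesic {x : V} {p : G.Walk x o} (hp : p.IsPath) : p = geodesic hG o x :=
  (hG.existsUnique_path x o).choose_spec.2 p hp

/-- The direct ancestor of `x` in the tree rooted at `o`: the next vertex on the path to `o`.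
The root is its own parent. -/
def parent (x : V) : V := (geodesic hG o x).snd

lemma geodesic_self : geodesic hG o o = .nil := (eq_geodesic hG .nil).symm

lemma parent_self : parent hG o o = o := by
  rw [parent, geodesic_self]; rfl

variable {o} in
lemma geodesic_of_ne {x : V} (hx : x ≠ o) :
    ∃ h : G.Adj x (parent hG o x), geodesic hG o x = .cons h (geodesic hG o (parent hG o x)) := by
  have hp := geodesic_isPath hG o x
  generalize hq : geodesic hG o x = q at hp
  cases q with
  | nil => exact absurd rfl hx
  | @cons _ w _ h q' =>
    have hw : parent hG o x = w := by simp [parent, hq]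
    subst hw
    exact ⟨h, by rw [eq_geodesic hG ((SimpleGraph.Walk.cons_isPath_iff h q').1 hp).1]⟩

variable {o} in
lemma adj_parent {x : V} (hx : x ≠ o) : G.Adj x (parent hG o x) := (geodesic_of_ne hG hx).1

lemma length_geodesic (x : V) : (geodesic hG o x).length = G.dist o x := by
  obtain ⟨p, hp, hl⟩ := hG.connected.exists_path_of_dist x o
  rw [← eq_geodesic hG hp, hl, SimpleGraph.dist_comm]

variable {o} in
lemma dist_parent {x : V} (hx : x ≠ o) : G.dist o x = G.dist o (parent hG o x) + 1 := by
  obtain ⟨h, he⟩ := geodesic_of_ne hG hx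
  rw [← length_geodesic hG, ← length_geodesic hG, he, SimpleGraph.Walk.length_cons]

lemma dist_iterate_parent (x : V) (k : ℕ) :
    G.dist o ((parent hG o)^[k] x) = G.dist o x - k := by
  induction k generalizing x with
  | zero => simp
  | succ k ih =>
    rw [Function.iterate_succ_apply, ih]
    by_cases hx : x = o
    · rw [hx, parent_self]; simp
    · rw [dist_parent hG hx]; omega

lemma iterate_parent_of_le {x : V} {k : ℕ} (hk : G.dist o x ≤ k) :
    (parent hG o)^[k] x = o := by
  have := dist_iterate_parent hG o x k
  rw [Nat.sub_eq_zero_of_le hk, hG.connected.dist_eq_zero_iff] at this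
  exact this.symm

variable {o} in
lemma eq_parent_or_eq_parent {x y : V} (h : G.Adj x y) :
    (x ≠ o ∧ parent hG o x = y) ∨ (y ≠ o ∧ parent hG o y = x) := by
  by_cases hy : y ∈ (geodesic hG o x).support
  · refine .inl ⟨?_, (hG.isAcyclic.eq_snd_of_adj_start (geodesic_isPath hG o x) h hy).symm⟩
    rintro rfl
    rw [geodesic_self] at hy
    simp only [SimpleGraph.Walk.support_nil, List.mem_singleton] at hy
    exact h.ne hy.symm
  · have he := eq_geodesic hG ((SimpleGraph.Walk.cons_isPath_iff h.symm _).2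
      ⟨geodesic_isPath hG o x, hy⟩)
    refine .inr ⟨?_, by rw [parent, ← he]; simp⟩
    rintro rfl
    exact hy (SimpleGraph.Walk.end_mem_support _)

lemma mem_support_geodesic {x z : V} :
    z ∈ (geodesic hG o x).support ↔ ∃ k, (parent hG o)^[k] x = z := by
  constructor
  · intro hz
    induction hn : G.dist o x generalizing x with
    | zero =>
      rw [hG.connected.dist_eq_zero_iff] at hn
      subst hn
      rw [geodesic_self] at hz
      exact ⟨0, by rw [SimpleGraph.Walk.support_nil, List.mem_singleton] at hz; exact hz.symm⟩
    | succ n ih =>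
      have hx : x ≠ o := by rintro rfl; simp at hn
      obtain ⟨h, he⟩ := geodesic_of_ne hG hx
      rw [he, SimpleGraph.Walk.support_cons, List.mem_cons] at hz
      rcases hz with rfl | hz
      · exact ⟨0, rfl⟩
      · obtain ⟨k, hk⟩ := ih hz (by have := dist_parent hG hx; omega)
        exact ⟨k + 1, hk⟩
  · rintro ⟨k, rfl⟩
    induction k generalizing x with
    | zero => exact SimpleGraph.Walk.start_mem_support _
    | succ k ih =>
      rw [Function.iterate_succ_apply]
      by_cases hx : x = o
      · subst hx
        rw [parent_self]
        exact ih
      · obtain ⟨h, he⟩ := geodesic_of_ne hG hx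
        rw [he, SimpleGraph.Walk.support_cons, List.mem_cons]
        exact .inr ih

lemma mem_cluster_iff {h : ℝ} {φ : V → ℝ} {y : V} :
    y ∈ cluster G o h φ ↔ ∀ k, h ≤ φ ((parent hG o)^[k] y) := by
  classical
  constructor
  · rintro ⟨p, hp⟩ k
    refine hp _ ?_
    have hmem := (mem_support_geodesic hG o (x := y)).2 ⟨k, rfl⟩
    rw [← eq_geodesic hG (p.reverse.toPath).2] at hmem
    simpa using p.reverse.support_toPath_subset_support hmem
  · intro hy
    refine ⟨(geodesic hG o y).reverse, fun z hz => ?_⟩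
    rw [SimpleGraph.Walk.support_reverse, List.mem_reverse, mem_support_geodesic] at hz
    obtain ⟨k, rfl⟩ := hz
    exact hy k

lemma branchingField_root (d : ℕ) (a : ℝ) (Y : V → ℝ) : branchingField hG d o a Y o = a := by
  rw [branchingField, geodesic_self, fieldAlong]

variable {o} in
lemma branchingField_of_ne (d : ℕ) (a : ℝ) (Y : V → ℝ) {x : V} (hx : x ≠ o) :
    branchingField hG d o a Y x
      = (1 / (d : ℝ)) * branchingField hG d o a Y (parent hG o x) + Y x := by
  obtain ⟨h, he⟩ := geodesic_of_ne hG hx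
  rw [branchingField, he, fieldAlong]
  rfl

variable [G.LocallyFinite]

open Classical in
/-- The children of `x` in the tree rooted at `o`. The root is its own parent, which is not among
its neighbours, so all its neighbours are children. -/
def children (x : V) : Finset V := (G.neighborFinset x).erase (parent hG o x)

lemma mem_children {x z : V} : z ∈ children hG o x ↔ z ≠ o ∧ parent hG o z = x := by
  classical
  rw [children, Finset.mem_erase, SimpleGraph.mem_neighborFinset]
  constructor
  · rintro ⟨h1, h2⟩
    rcases eq_parent_or_eq_parent hG (o := o) h2 with h | h
    exacts [absurd h.2.symm h1, h]
  · rintro ⟨h1, rfl⟩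
    refine ⟨fun he => ?_, (adj_parent hG h1).symm⟩
    have e1 := dist_parent hG h1
    by_cases h2 : parent hG o z = o
    · rw [h2, parent_self] at he
      exact h1 he
    · have e2 := dist_parent hG h2
      rw [← he] at e2
      omega

lemma children_root : children hG o o = G.neighborFinset o := by
  classical
  rw [children, parent_self, Finset.erase_eq_of_notMem (by simp)]

variable {o} in
lemma card_children {d : ℕ} (hreg : G.IsRegularOfDegree (d + 1)) {x : V} (hx : x ≠ o) :
    (children hG o x).card = d := by
  classical
  rw [children, Finset.card_erase_of_mem (by simpa using adj_parent hG hx),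
    SimpleGraph.card_neighborFinset_eq_degree, hreg x, Nat.add_sub_cancel]

variable {o} in
lemma sum_neighborFinset_of_ne {M : Type*} [AddCommMonoid M] (f : V → M) {x : V} (hx : x ≠ o) :
    ∑ z ∈ G.neighborFinset x, f z = f (parent hG o x) + ∑ z ∈ children hG o x, f z := by
  classical
  rw [children, Finset.add_sum_erase _ f (by simpa using adj_parent hG hx)]

lemma finite_ball (hG : G.IsTree) (o : V) (n : ℕ) : {y | G.dist o y ≤ n}.Finite := by
  induction n with
  | zero =>
    refine (finite_singleton o).subset fun y hy => ?_
    rw [mem_ofPred_eq, Nat.le_zero, hG.connected.dist_eq_zero_iff] at hy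
    exact hy.symm
  | succ n ih =>
    refine ((finite_singleton o).union (ih.biUnion fun x _ =>
      (G.neighborFinset x).finite_toSet)).subset fun y hy => ?_
    by_cases hyo : y = o
    · exact .inl hyo
    · refine .inr (mem_biUnion (x := parent hG o y) ?_ ?_)
      · have := dist_parent hG hyo
        simp only [mem_ofPred_eq] at hy ⊢
        omega
      · simpa using (adj_parent hG hyo).symm

/-! ### Survival of the level set along the tree -/

/-- Starting from the vertex `x` with value `b`, the level set above `h` of the field driven by `Y`
contains a line of descent of `n` generations below `x`. -/
def SurvivesTo (d : ℕ) (h : ℝ) : ℕ → V → ℝ → (V → ℝ) → Prop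
  | 0, _, b, _ => h ≤ b
  | n + 1, x, b, Y => h ≤ b ∧ ∃ z ∈ children hG o x, SurvivesTo d h n z ((1 / (d : ℝ)) * b + Y z) Y

/-- The same at the root with value `a`, with the first generation restricted to `S`. -/
def RootSurvivesTo (d : ℕ) (h : ℝ) (S : Finset V) (n : ℕ) (a : ℝ) (Y : V → ℝ) : Prop :=
  h ≤ a ∧ ∃ z ∈ S, SurvivesTo hG o d h n z ((1 / (d : ℝ)) * a + Y z) Y

lemma survivesTo_of_succ {d : ℕ} {h : ℝ} {n : ℕ} {x : V} {b : ℝ} {Y : V → ℝ}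
    (hs : SurvivesTo hG o d h (n + 1) x b Y) : SurvivesTo hG o d h n x b Y := by
  induction n generalizing x b with
  | zero => exact hs.1
  | succ n ih =>
    obtain ⟨hb, z, hz, hsz⟩ := hs
    exact ⟨hb, z, hz, ih hsz⟩

lemma survivesTo_iff {d : ℕ} {h : ℝ} {φ Y : V → ℝ}
    (hφ : ∀ z, z ≠ o → φ z = (1 / (d : ℝ)) * φ (parent hG o z) + Y z) (n : ℕ) (x : V) :
    SurvivesTo hG o d h n x (φ x) Y ↔ ∃ y, (parent hG o)^[n] y = x ∧
      G.dist o y = G.dist o x + n ∧ ∀ k ≤ n, h ≤ φ ((parent hG o)^[k] y) := by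
  induction n generalizing x with
  | zero =>
    constructor
    · intro hx
      refine ⟨x, rfl, rfl, fun k hk => ?_⟩
      obtain rfl : k = 0 := by omega
      exact hx
    · rintro ⟨y, rfl, -, hy⟩
      exact hy 0 le_rfl
  | succ n ih =>
    constructor
    · rintro ⟨hx, z, hz, hs⟩
      obtain ⟨hzo, rfl⟩ := (mem_children hG o).1 hz
      rw [← hφ z hzo, ih] at hs
      obtain ⟨y, rfl, hd, hy⟩ := hs
      have hp := dist_parent hG hzo
      refine ⟨y, Function.iterate_succ_apply' _ _ _, by omega, fun k hk => ?_⟩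
      rcases Nat.lt_or_ge n k with hnk | hnk
      · obtain rfl : k = n + 1 := by omega
        rw [Function.iterate_succ_apply']; exact hx
      · exact hy k hnk
    · rintro ⟨y, rfl, hd, hy⟩
      have h1 := dist_iterate_parent hG o y n
      have hzo : (parent hG o)^[n] y ≠ o := by
        intro he
        rw [he, SimpleGraph.dist_self] at h1
        omega
      refine ⟨hy _ le_rfl, (parent hG o)^[n] y,
        (mem_children hG o).2 ⟨hzo, (Function.iterate_succ_apply' _ _ _).symm⟩, ?_⟩
      rw [Function.iterate_succ_apply', ← hφ _ hzo, ih]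
      exact ⟨y, rfl, by omega, fun k hk => hy k (by omega)⟩

/-- The part of the tree below a set `S` of children of the root, together with the root. -/
def subtree (S : Finset V) : Set V := {y | y = o ∨ ∃ k, (parent hG o)^[k] y ∈ S}

lemma dist_of_mem_children_root {z : V} (hz : z ∈ children hG o o) : G.dist o z = 1 := by
  rw [children_root, SimpleGraph.mem_neighborFinset] at hz
  exact SimpleGraph.dist_eq_one_iff_adj.2 hz

lemma exists_iterate_mem_children_root {y : V} (hy : y ≠ o) :
    ∃ k, (parent hG o)^[k] y ∈ children hG o o := by
  have hpos := hG.connected.pos_dist_of_ne hy.symm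
  refine ⟨G.dist o y - 1, ?_⟩
  rw [children_root, SimpleGraph.mem_neighborFinset, ← SimpleGraph.dist_eq_one_iff_adj,
    dist_iterate_parent]
  omega

lemma subtree_children_root : subtree hG o (children hG o o) = univ := by
  refine eq_univ_of_forall fun y => ?_
  by_cases hy : y = o
  exacts [.inl hy, .inr (exists_iterate_mem_children_root hG o hy)]

open Classical in
lemma subtree_erase {obar : V} (hobar : G.Adj o obar) :
    subtree hG o ((children hG o o).erase obar) = forwardTree hG o obar := by
  ext y
  simp only [subtree, forwardTree, mem_ofPred_eq, mem_support_geodesic, Finset.mem_erase]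
  have hd : G.dist o obar = 1 := SimpleGraph.dist_eq_one_iff_adj.2 hobar
  constructor
  · rintro (rfl | ⟨k, hk, hk'⟩) ⟨j, hj⟩
    · rw [Function.iterate_fixed (parent_self hG _)] at hj
      exact hobar.ne hj
    · have h1 := dist_iterate_parent hG o y k
      have h2 := dist_iterate_parent hG o y j
      rw [dist_of_mem_children_root hG o hk'] at h1
      rw [hj, hd] at h2
      obtain rfl : k = j := by omega
      exact hk hj
  · intro hy
    by_cases hyo : y = o
    · exact .inl hyo
    · obtain ⟨k, hk⟩ := exists_iterate_mem_children_root hG o hyo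
      exact .inr ⟨k, fun he => hy ⟨k, he⟩, hk⟩

/-- Since the tree is locally finite, the component of the root is infinite if and only if it
contains lines of descent of any length. -/
lemma infinite_cluster_iff {d : ℕ} {h : ℝ} {S : Finset V} (hS : S ⊆ children hG o o)
    {φ Y : V → ℝ} (hφ : ∀ z, z ≠ o → φ z = (1 / (d : ℝ)) * φ (parent hG o z) + Y z) :
    (cluster G o h φ ∩ subtree hG o S).Infinite ↔
      ∀ n, RootSurvivesTo hG o d h S n (φ o) Y := by
  have hφS : ∀ z ∈ S, (1 / (d : ℝ)) * φ o + Y z = φ z := fun z hz => by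
    obtain ⟨h1, h2⟩ := (mem_children hG o).1 (hS hz)
    rw [hφ z h1, h2]
  constructor
  · intro hinf n
    obtain ⟨y, ⟨hyc, hyS⟩, hyn⟩ := (hinf.sdiff (finite_ball hG o n)).nonempty
    rw [mem_cluster_iff hG] at hyc
    rw [mem_ofPred_eq, not_le] at hyn
    have hyo : y ≠ o := by rintro rfl; simp at hyn
    obtain ⟨k, hk⟩ := hyS.resolve_left hyo
    have hkd := dist_iterate_parent hG o y k
    rw [dist_of_mem_children_root hG o (hS hk)] at hkd
    refine ⟨by simpa [iterate_parent_of_le hG o le_rfl] using hyc (G.dist o y), _, hk, ?_⟩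
    rw [hφS _ hk, survivesTo_iff hG o hφ]
    refine ⟨(parent hG o)^[k - n] y, ?_, ?_, fun j _ => ?_⟩
    · rw [← Function.iterate_add_apply]; congr 2; omega
    · rw [dist_iterate_parent, dist_iterate_parent]; omega
    · rw [← Function.iterate_add_apply]; exact hyc _
  · intro hs
    have hex : ∀ n, ∃ y ∈ cluster G o h φ ∩ subtree hG o S, G.dist o y = n + 1 := by
      intro n
      obtain ⟨ha, z, hz, hsz⟩ := hs n
      rw [hφS z hz, survivesTo_iff hG o hφ] at hsz
      obtain ⟨y, rfl, hd, hy⟩ := hsz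
      rw [dist_of_mem_children_root hG o (hS hz), add_comm] at hd
      refine ⟨y, ⟨(mem_cluster_iff hG o).2 fun k => ?_, .inr ⟨n, hz⟩⟩, hd⟩
      rcases Nat.lt_or_ge n k with hk | hk
      · rw [iterate_parent_of_le hG o (by omega)]; exact ha
      · exact hy k hk
    choose y hy hyd using hex
    refine infinite_of_injective_forall_mem (f := y) (fun m n hmn => ?_) hy
    have h1 := hyd m
    have h2 := hyd n
    rw [hmn] at h1
    omega

end Tree

/-! ### Independence along the tree -/

section Independence

variable {V Ω : Type*} {Y : V → Ω → ℝ}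

open Classical in
/-- The noise `Y`, set to zero outside `D`. -/
def truncate (Y : V → Ω → ℝ) (D : Set V) (ω : Ω) : V → ℝ := fun v => if v ∈ D then Y v ω else 0

lemma truncate_of_mem {D : Set V} {v : V} (hv : v ∈ D) (ω : Ω) : truncate Y D ω v = Y v ω :=
  if_pos hv

lemma comap_truncate_le (D : Set V) :
    MeasurableSpace.comap (truncate Y D) inferInstance
      ≤ ⨆ v ∈ D, MeasurableSpace.comap (Y v) inferInstance := by
  rw [← measurable_iff_comap_le]
  refine @measurable_pi_lambda _ _ _ (_) _ _ fun v => ?_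
  unfold truncate
  split_ifs with hv
  · rw [measurable_iff_comap_le]
    exact le_iSup₂_of_le v hv le_rfl
  · exact @measurable_const _ _ _ (_) _

variable [MeasurableSpace Ω] {μ : Measure Ω}

lemma measurable_truncate (hY : ∀ v, Measurable (Y v)) (D : Set V) :
    Measurable (truncate Y D) := by
  refine measurable_pi_lambda _ fun v => ?_
  unfold truncate
  split_ifs
  exacts [hY v, measurable_const]

lemma indepFun_truncate (hY : ∀ v, Measurable (Y v)) (hI : iIndepFun Y μ) {D E : Set V}
    (hDE : Disjoint D E) : IndepFun (truncate Y D) (truncate Y E) μ := by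
  rw [IndepFun_iff_Indep]
  exact indep_of_indep_of_le_left (indep_of_indep_of_le_right
    (indep_iSup_of_disjoint (fun v => (hY v).comap_le) ((iIndepFun_iff_iIndep _ _ _).1 hI) hDE)
    (comap_truncate_le E)) (comap_truncate_le D)

/-- An event depending on the noise at `x` and on the noise in a set `D` not containing `x` can be
integrated over the noise at `x` first. -/
lemma measure_eq_lintegral_map [IsProbabilityMeasure μ] (hY : ∀ v, Measurable (Y v))
    (hI : iIndepFun Y μ) {x : V}
    {D : Set V} (hx : x ∉ D) {A : Set (ℝ × (V → ℝ))} (hA : MeasurableSet A)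
    (hAD : ∀ b (y y' : V → ℝ), (∀ v ∈ D, y v = y' v) → ((b, y) ∈ A ↔ (b, y') ∈ A)) :
    μ {ω | (Y x ω, fun v => Y v ω) ∈ A}
      = ∫⁻ b, μ {ω | (b, fun v => Y v ω) ∈ A} ∂(μ.map (Y x)) := by
  have hW := measurable_truncate hY D
  have hind : IndepFun (Y x) (truncate Y D) μ := by
    have h1 := (indepFun_truncate hY hI (Set.disjoint_singleton_left.2 hx)).comp
      (measurable_pi_apply x) measurable_id
    have h2 : (fun y : V → ℝ => y x) ∘ truncate Y {x} = Y x :=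
      funext fun ω => truncate_of_mem (mem_singleton x) ω
    simpa only [h2, Function.id_comp] using h1
  have hprod := (indepFun_iff_map_prod_eq_prod_map_map (hY x).aemeasurable hW.aemeasurable).1 hind
  have htr : ∀ b ω, ((b, fun v => Y v ω) ∈ A ↔ (b, truncate Y D ω) ∈ A) := fun b ω =>
    hAD b _ _ fun v hv => (truncate_of_mem hv ω).symm
  simp only [htr]
  have e1 : {ω | (Y x ω, truncate Y D ω) ∈ A} = (fun ω => (Y x ω, truncate Y D ω)) ⁻¹' A := rfl
  have := Measure.isProbabilityMeasure_map (μ := μ) hW.aemeasurable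
  rw [e1, ← Measure.map_apply ((hY x).prodMk hW) hA, hprod, Measure.prod_apply hA]
  refine lintegral_congr fun b => ?_
  rw [Measure.map_apply hW (measurable_prodMk_left hA)]
  rfl

end Independence

/-! ### The law of survival -/

section Law

variable {V : Type*} {G : SimpleGraph V} (hG : G.IsTree) (o : V)

/-- The set of descendants of `x`, including `x`. -/
def descendants (x : V) : Set V := {v | ∃ k, (parent hG o)^[k] v = x}

lemma self_mem_descendants (x : V) : x ∈ descendants hG o x := ⟨0, rfl⟩

variable [G.LocallyFinite]

lemma dist_of_mem_children {x z : V} (hz : z ∈ children hG o x) :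
    G.dist o z = G.dist o x + 1 := by
  obtain ⟨h1, rfl⟩ := (mem_children hG o).1 hz
  exact dist_parent hG h1

lemma descendants_subset {x z : V} (hz : z ∈ children hG o x) :
    descendants hG o z ⊆ descendants hG o x := by
  rintro v ⟨k, rfl⟩
  exact ⟨k + 1, by rw [Function.iterate_succ_apply', ((mem_children hG o).1 hz).2]⟩

lemma notMem_descendants {x z : V} (hz : z ∈ children hG o x) : x ∉ descendants hG o z := by
  rintro ⟨k, rfl⟩
  have h1 := dist_of_mem_children hG o hz
  have h2 := dist_iterate_parent hG o x k
  omega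

lemma disjoint_descendants {x z w : V} (hz : z ∈ children hG o x) (hw : w ∈ children hG o x)
    (hzw : z ≠ w) : Disjoint (descendants hG o z) (descendants hG o w) := by
  refine Set.disjoint_left.2 ?_
  rintro v ⟨k, hk⟩ ⟨j, hj⟩
  have h1 := dist_iterate_parent hG o v k
  have h2 := dist_iterate_parent hG o v j
  rw [hk, dist_of_mem_children hG o hz] at h1
  rw [hj, dist_of_mem_children hG o hw] at h2
  obtain rfl : k = j := by omega
  exact hzw (hk.symm.trans hj)

lemma survivesTo_congr {d : ℕ} {h : ℝ} {n : ℕ} {x : V} {b : ℝ} {y y' : V → ℝ}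
    (hyy : ∀ z ∈ children hG o x, ∀ v ∈ descendants hG o z, y v = y' v) :
    SurvivesTo hG o d h n x b y ↔ SurvivesTo hG o d h n x b y' := by
  induction n generalizing x b with
  | zero => exact Iff.rfl
  | succ n ih =>
    refine and_congr_right fun _ => exists_congr fun z => and_congr_right fun hz => ?_
    rw [hyy z hz z (self_mem_descendants hG o z)]
    exact ih fun w hw v hv => hyy z hz v (descendants_subset hG o hw hv)

lemma measurableSet_survivesTo (d : ℕ) (h : ℝ) (n : ℕ) (x : V) :
    MeasurableSet {p : ℝ × (V → ℝ) | SurvivesTo hG o d h n x p.1 p.2} := by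
  induction n generalizing x with
  | zero => exact measurableSet_le measurable_const measurable_fst
  | succ n ih =>
    have : {p : ℝ × (V → ℝ) | SurvivesTo hG o d h (n + 1) x p.1 p.2}
        = {p | h ≤ p.1} ∩ ⋃ z ∈ children hG o x, (fun p : ℝ × (V → ℝ) =>
          ((1 / (d : ℝ)) * p.1 + p.2 z, p.2)) ⁻¹' {p | SurvivesTo hG o d h n z p.1 p.2} := by
      ext p; simp [SurvivesTo]
    rw [this]
    exact (measurableSet_le measurable_const measurable_fst).inter
      (Finset.measurableSet_biUnion _ fun z _ => (ih z).preimage (by fun_prop))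

lemma measurableSet_rootSurvivesTo (d : ℕ) (h : ℝ) (S : Finset V) (n : ℕ) :
    MeasurableSet {p : ℝ × (V → ℝ) | RootSurvivesTo hG o d h S n p.1 p.2} := by
  have : {p : ℝ × (V → ℝ) | RootSurvivesTo hG o d h S n p.1 p.2}
      = {p | h ≤ p.1} ∩ ⋃ z ∈ S, (fun p : ℝ × (V → ℝ) =>
        ((1 / (d : ℝ)) * p.1 + p.2 z, p.2)) ⁻¹' {p | SurvivesTo hG o d h n z p.1 p.2} := by
    ext p; simp [RootSurvivesTo]
  rw [this]
  exact (measurableSet_le measurable_const measurable_fst).inter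
    (Finset.measurableSet_biUnion _ fun z _ =>
      (measurableSet_survivesTo hG o d h n z).preimage (by fun_prop))

lemma rootSurvivesTo_antitone (d : ℕ) (h : ℝ) (S : Finset V) (a : ℝ) (y : V → ℝ) :
    Antitone (fun n => RootSurvivesTo hG o d h S n a y) :=
  antitone_nat_of_succ_le fun _ ⟨ha, z, hz, hs⟩ => ⟨ha, z, hz, survivesTo_of_succ hG o hs⟩

variable {Ω : Type*} [MeasurableSpace Ω] {μ : Measure Ω} [IsProbabilityMeasure μ]
  {Y : V → Ω → ℝ}

lemma measurableSet_survivesTo_child (hY : ∀ v, Measurable (Y v)) (d : ℕ) (h : ℝ) (n : ℕ)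
    (z : V) (c : ℝ) :
    MeasurableSet {ω | SurvivesTo hG o d h n z (c + Y z ω) fun v => Y v ω} :=
  (measurableSet_survivesTo hG o d h n z).preimage
    (f := fun ω => (c + Y z ω, fun v => Y v ω))
    (((hY z).const_add c).prodMk (measurable_pi_lambda _ hY))

/-- The lines of descent through different children are independent. -/
lemma measureReal_exists_survivesTo (hY : ∀ v, Measurable (Y v)) (hI : iIndepFun Y μ)
    {d : ℕ} {h : ℝ} {n : ℕ} {x : V} {S : Finset V} (hS : S ⊆ children hG o x) {c q : ℝ}
    (hq : ∀ z ∈ S, μ.real {ω | SurvivesTo hG o d h n z (c + Y z ω) fun v => Y v ω} = q) :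
    μ.real {ω | ∃ z ∈ S, SurvivesTo hG o d h n z (c + Y z ω) fun v => Y v ω}
      = 1 - (1 - q) ^ S.card := by
  classical
  have hm := measurableSet_survivesTo_child hG o hY d h n (c := c)
  -- the descendants of the children in `T` determine the event that none of these survives
  have hloc : ∀ T ⊆ S, {ω | ∀ z ∈ T, ¬ SurvivesTo hG o d h n z (c + Y z ω) fun v => Y v ω}
      = truncate Y (⋃ z ∈ T, descendants hG o z) ⁻¹'
        {y | ∀ z ∈ T, ¬ SurvivesTo hG o d h n z (c + y z) y} := by
    intro T hT
    ext ω
    refine forall₂_congr fun z hz => not_congr ?_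
    have hsub : descendants hG o z ⊆ ⋃ z ∈ T, descendants hG o z :=
      subset_biUnion_of_mem (u := fun z => descendants hG o z) hz
    rw [truncate_of_mem (hsub (self_mem_descendants hG o z))]
    exact survivesTo_congr hG o fun w hw v hv =>
      (truncate_of_mem (hsub (descendants_subset hG o hw hv)) ω).symm
  have hmeas : ∀ T : Finset V,
      MeasurableSet {y : V → ℝ | ∀ z ∈ T, ¬ SurvivesTo hG o d h n z (c + y z) y} := by
    intro T
    simp only [Set.ofPred_forall]
    exact Finset.measurableSet_biInter _ fun z _ =>
      ((measurableSet_survivesTo hG o d h n z).preimage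
        (f := fun y : V → ℝ => (c + y z, y)) (by fun_prop)).compl
  have hnone : ∀ T ⊆ S,
      μ.real {ω | ∀ z ∈ T, ¬ SurvivesTo hG o d h n z (c + Y z ω) fun v => Y v ω}
        = (1 - q) ^ T.card := by
    intro T
    induction T using Finset.induction_on with
    | empty => intro _; simp
    | insert z T hz ih =>
      intro hT
      have hTS : T ⊆ S := (Finset.subset_insert z T).trans hT
      have hzS : z ∈ S := hT (Finset.mem_insert_self z T)
      have hsplit : {ω | ∀ w ∈ insert z T, ¬ SurvivesTo hG o d h n w (c + Y w ω) fun v => Y v ω}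
          = {ω | ∀ w ∈ ({z} : Finset V), ¬ SurvivesTo hG o d h n w (c + Y w ω) fun v => Y v ω} ∩
            {ω | ∀ w ∈ T, ¬ SurvivesTo hG o d h n w (c + Y w ω) fun v => Y v ω} := by
        ext ω; simp
      have hdisj : Disjoint (⋃ w ∈ ({z} : Finset V), descendants hG o w)
          (⋃ w ∈ T, descendants hG o w) := by
        simp only [Finset.mem_singleton, iUnion_iUnion_eq_left, disjoint_iUnion_right]
        exact fun w hw => disjoint_descendants hG o (hS hzS) (hS (hTS hw))
          (fun he => hz (he ▸ hw))
      have hone : μ.real {ω | ∀ w ∈ ({z} : Finset V),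
          ¬ SurvivesTo hG o d h n w (c + Y w ω) fun v => Y v ω} = 1 - q := by
        have : {ω | ∀ w ∈ ({z} : Finset V), ¬ SurvivesTo hG o d h n w (c + Y w ω) fun v => Y v ω}
            = {ω | SurvivesTo hG o d h n z (c + Y z ω) fun v => Y v ω}ᶜ := by ext ω; simp
        rw [this, probReal_compl_eq_one_sub (hm z), hq z hzS]
      have hmul := congrArg ENNReal.toReal
        ((indepFun_truncate hY hI hdisj).measure_inter_preimage_eq_mul _ _ (hmeas {z}) (hmeas T))
      rw [ENNReal.toReal_mul] at hmul
      simp only [← measureReal_def] at hmul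
      rw [← hloc T hTS, ← hloc {z} (by simpa using hzS), ← hsplit, hone, ih hTS] at hmul
      rw [hmul, Finset.card_insert_of_notMem hz, pow_succ, mul_comm]
  have hcompl : {ω | ∃ z ∈ S, SurvivesTo hG o d h n z (c + Y z ω) fun v => Y v ω}
      = {ω | ∀ z ∈ S, ¬ SurvivesTo hG o d h n z (c + Y z ω) fun v => Y v ω}ᶜ := by
    ext ω; simp
  have hms : MeasurableSet
      {ω | ∀ z ∈ S, ¬ SurvivesTo hG o d h n z (c + Y z ω) fun v => Y v ω} := by
    rw [hloc S subset_rfl]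
    exact (hmeas S).preimage (measurable_truncate hY _)
  rw [hcompl, probReal_compl_eq_one_sub hms, hnone S subset_rfl]

/-- Integrating over the noise at a child turns survival probabilities from a given value into
their image under the transition operator. -/
lemma measureReal_survivesTo_child (hY : ∀ v, Measurable (Y v)) (hI : iIndepFun Y μ)
    {d : ℕ} {h : ℝ} {n : ℕ} {z : V} (hYz : μ.map (Y z) = noiseLaw d)
    (hz : ∀ b, μ.real {ω | SurvivesTo hG o d h n z b fun v => Y v ω} = survivalUpTo d h n b)
    (b : ℝ) :
    μ.real {ω | SurvivesTo hG o d h n z ((1 / (d : ℝ)) * b + Y z ω) fun v => Y v ω}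
      = transition d (survivalUpTo d h n) b := by
  have hA : MeasurableSet {p : ℝ × (V → ℝ) |
      SurvivesTo hG o d h n z ((1 / (d : ℝ)) * b + p.1) p.2} :=
    (measurableSet_survivesTo hG o d h n z).preimage
      (f := fun p : ℝ × (V → ℝ) => ((1 / (d : ℝ)) * b + p.1, p.2)) (by fun_prop)
  have key := measure_eq_lintegral_map (x := z) hY hI
    (D := ⋃ w ∈ children hG o z, descendants hG o w)
    (by simpa using fun w hw => notMem_descendants hG o hw) hA
    (fun c y y' hyy => survivesTo_congr hG o fun w hw v hv => hyy v (mem_biUnion hw hv))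
  simp only [mem_ofPred_eq] at key
  have hp := isProfile_survivalUpTo d h n
  rw [measureReal_def, key, hYz, transition,
    integral_eq_lintegral_of_nonneg_ae (ae_of_all _ fun _ => hp.nonneg _)
      (hp.integrable_shift _).aestronglyMeasurable]
  congr 1
  refine lintegral_congr fun y => ?_
  rw [← hz, ofReal_measureReal]

variable {o}

lemma measureReal_survivesTo (hY : ∀ v, Measurable (Y v)) (hI : iIndepFun Y μ) {d : ℕ}
    (hYl : ∀ v, v ≠ o → μ.map (Y v) = noiseLaw d) (hreg : G.IsRegularOfDegree (d + 1)) (h : ℝ)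
    (n : ℕ) {x : V} (hx : x ≠ o) (b : ℝ) :
    μ.real {ω | SurvivesTo hG o d h n x b fun v => Y v ω} = survivalUpTo d h n b := by
  induction n generalizing x b with
  | zero =>
    simp only [SurvivesTo, survivalUpTo]
    split_ifs with hb <;> simp [hb]
  | succ n ih =>
    simp only [SurvivesTo, survivalUpTo, survivalStep]
    split_ifs with hb
    · simp only [hb, true_and]
      rw [measureReal_exists_survivesTo hG o hY hI subset_rfl fun z hz =>
        measureReal_survivesTo_child hG o hY hI (hYl z ((mem_children hG o).1 hz).1)
          (ih ((mem_children hG o).1 hz).1) b, card_children hG hreg hx]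
    · simp [hb]

open Classical in
/-- The probability of infinite survival from the value `a` at the root. -/
lemma measureReal_forall_rootSurvivesTo (hY : ∀ v, Measurable (Y v)) (hI : iIndepFun Y μ) {d : ℕ}
    (hd : 2 ≤ d) (hYl : ∀ v, v ≠ o → μ.map (Y v) = noiseLaw d)
    (hreg : G.IsRegularOfDegree (d + 1)) (h a : ℝ) {S : Finset V} (hS : S ⊆ children hG o o) :
    μ.real {ω | ∀ n, RootSurvivesTo hG o d h S n a fun v => Y v ω}
      = if h ≤ a then 1 - (1 - transition d (survival d h) a) ^ S.card else 0 := by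
  have hn : ∀ n, μ.real {ω | RootSurvivesTo hG o d h S n a fun v => Y v ω}
      = if h ≤ a then 1 - (1 - transition d (survivalUpTo d h n) a) ^ S.card else 0 := by
    intro n
    simp only [RootSurvivesTo]
    split_ifs with ha
    · simp only [ha, true_and]
      exact measureReal_exists_survivesTo hG o hY hI hS fun z hz =>
        measureReal_survivesTo_child hG o hY hI (hYl z ((mem_children hG o).1 (hS hz)).1)
          (measureReal_survivesTo hG hY hI hYl hreg h n ((mem_children hG o).1 (hS hz)).1) a
    · simp [ha]
  have hlim := tendsto_measure_iInter_atTop (μ := μ)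
    (s := fun n => {ω | RootSurvivesTo hG o d h S n a fun v => Y v ω})
    (fun n => ((measurableSet_rootSurvivesTo hG o d h S n).preimage
      (f := fun ω => (a, fun v => Y v ω))
      (measurable_const.prodMk (measurable_pi_lambda _ hY))).nullMeasurableSet)
    (fun m n hmn ω hω => rootSurvivesTo_antitone hG o d h S a _ hmn hω)
    ⟨0, measure_ne_top _ _⟩
  have hlim' := (ENNReal.tendsto_toReal (measure_ne_top μ _)).comp hlim
  rw [Set.ofPred_forall]
  refine tendsto_nhds_unique hlim' (Tendsto.congr (fun n => (hn n).symm) ?_)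
  split_ifs
  · exact (((tendsto_transition_survivalUpTo hd h a).const_sub 1).pow _).const_sub 1
  · exact tendsto_const_nhds

end Law

/-! ### Percolation probabilities of the conditional field -/

section Percolation

variable {V : Type*} {G : SimpleGraph V} (hG : G.IsTree) (o : V)

open Classical in
/-- The noise driving a field `φ`: at the root the value itself, and elsewhere the part of the value
that does not come from the parent. -/
def innovation (d : ℕ) (φ : V → ℝ) (x : V) : ℝ :=
  if x = o then φ o else φ x - (1 / (d : ℝ)) * φ (parent hG o x)

lemma innovation_root (d : ℕ) (φ : V → ℝ) : innovation hG o d φ o = φ o := if_pos rfl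

variable {o} in
lemma innovation_of_ne (d : ℕ) (φ : V → ℝ) {x : V} (hx : x ≠ o) :
    innovation hG o d φ x = φ x - (1 / (d : ℝ)) * φ (parent hG o x) := if_neg hx

lemma eq_add_innovation (d : ℕ) (φ : V → ℝ) (x : V) (hx : x ≠ o) :
    φ x = (1 / (d : ℝ)) * φ (parent hG o x) + innovation hG o d φ x := by
  rw [innovation_of_ne hG d φ hx]; ring

lemma measurable_innovation (d : ℕ) (x : V) :
    Measurable (fun φ : V → ℝ => innovation hG o d φ x) := by
  unfold innovation
  split_ifs <;> fun_prop

variable [G.LocallyFinite]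

lemma setOf_infinite_cluster_eq (d : ℕ) (h : ℝ) {S : Finset V} (hS : S ⊆ children hG o o) :
    {φ : V → ℝ | (cluster G o h φ ∩ subtree hG o S).Infinite}
      = {φ | ∀ n, RootSurvivesTo hG o d h S n (φ o) (innovation hG o d φ)} :=
  Set.ext fun φ => infinite_cluster_iff hG o hS (eq_add_innovation hG o d φ)

lemma measurableSet_infinite_cluster {d : ℕ} (h : ℝ) {S : Finset V} (hS : S ⊆ children hG o o) :
    MeasurableSet {φ : V → ℝ | (cluster G o h φ ∩ subtree hG o S).Infinite} := by
  rw [setOf_infinite_cluster_eq hG o d h hS, Set.ofPred_forall]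
  exact MeasurableSet.iInter fun n => (measurableSet_rootSurvivesTo hG o d h S n).preimage
    (f := fun φ : V → ℝ => (φ o, innovation hG o d φ))
    ((measurable_pi_apply o).prodMk (measurable_pi_lambda _ (measurable_innovation hG o d)))

open Classical in
/-- The percolation probability given the value at the root, in terms of the survival probability
in the forward tree. -/
lemma condLaw_real_infinite_cluster {d : ℕ} (hd : 2 ≤ d) (hreg : G.IsRegularOfDegree (d + 1))
    (h a : ℝ) {S : Finset V} (hS : S ⊆ children hG o o) :
    (condLaw hG d o a).real {φ | (cluster G o h φ ∩ subtree hG o S).Infinite}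
      = if h ≤ a then 1 - (1 - transition d (survival d h) a) ^ S.card else 0 := by
  rw [condLaw, map_measureReal_apply (measurable_branchingField hG d o a)
    (measurableSet_infinite_cluster hG o (d := d) h hS)]
  have hpre : branchingField hG d o a ⁻¹' {φ | (cluster G o h φ ∩ subtree hG o S).Infinite}
      = {Y | ∀ n, RootSurvivesTo hG o d h S n a fun v => Y v} := by
    ext Y
    refine (infinite_cluster_iff hG o hS (φ := branchingField hG d o a Y) (Y := Y)
      (fun z hz => branchingField_of_ne hG d a Y hz)).trans ?_
    rw [branchingField_root]
    rfl
  rw [hpre]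
  exact measureReal_forall_rootSurvivesTo hG (Y := fun v (ω : V → ℝ) => ω v)
    (fun v => measurable_pi_apply v)
    (iIndepFun_infinitePi (X := fun _ ω => ω) fun _ => measurable_id) hd
    (fun v _ => Measure.infinitePi_map_eval _ v) hreg h a hS

end Percolation

/-- If the value at the root is at least the height, the percolation probability is a continuous
function of the height; it vanishes at larger heights, so that the only possible jump is at
the value of the root. -/
lemma continuity_of_eq_ite {η k : ℝ → ℝ} {a : ℝ} {m : ℕ} (hk : Continuous k)
    (hη : ∀ h, η h = open Classical in if h ≤ a then 1 - (1 - k h) ^ m else 0) :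
    (k a = 0 → Continuous η) ∧ (∀ h, h ≠ a → ContinuousAt η h) ∧
      ContinuousWithinAt η (Iic a) a := by
  classical
  have hF : Continuous fun h => 1 - (1 - k h) ^ m := by fun_prop
  have hleft : ∀ h ∈ Iic a, η h = 1 - (1 - k h) ^ m := fun h hh => by
    rw [hη, if_pos (mem_Iic.1 hh)]
  have h1 : ContinuousWithinAt η (Iic a) a :=
    hF.continuousWithinAt.congr hleft (hleft a self_mem_Iic)
  have h2 : ∀ h, h ≠ a → ContinuousAt η h := by
    intro h hh
    rcases lt_or_gt_of_ne hh with hh | hh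
    · exact hF.continuousAt.congr (by
        filter_upwards [Iio_mem_nhds hh] with x hx
        exact (hleft x (mem_Iio.1 hx).le).symm)
    · exact (continuousAt_const (y := (0 : ℝ))).congr (by
        filter_upwards [Ioi_mem_nhds hh] with x hx
        rw [hη, if_neg (mem_Ioi.1 hx).not_ge])
  refine ⟨fun h0 => continuous_iff_continuousAt.2 fun h => ?_, h2, h1⟩
  by_cases hh : h = a
  · subst hh
    refine continuousAt_iff_continuous_left_right.2 ⟨h1, ?_⟩
    have hz : ∀ x ∈ Ici h, η x = 0 := fun x hx => by
      rcases eq_or_lt_of_le (mem_Ici.1 hx) with rfl | hx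
      · rw [hleft _ self_mem_Iic, h0]; simp
      · rw [hη, if_neg hx.not_ge]
    exact continuousWithinAt_const.congr hz (hz h self_mem_Ici)
  · exact h2 h hh

/-! ### The Green function of the regular tree -/

section Green

variable {V : Type*} {G : SimpleGraph V} [G.LocallyFinite]

lemma sum_pow_dist (hG : G.IsTree) {d : ℕ} (hreg : G.IsRegularOfDegree (d + 1)) (r : ℝ)
    {x y : V} (hxy : x ≠ y) : ∑ z ∈ G.neighborFinset x, r ^ G.dist y z
      = r ^ (G.dist y x - 1) + d * r ^ (G.dist y x + 1) := by
  have hp := dist_parent hG hxy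
  rw [sum_neighborFinset_of_ne hG _ hxy, Finset.sum_congr rfl fun z hz => by
    rw [dist_of_mem_children hG y hz], Finset.sum_const, card_children hG hreg hxy, nsmul_eq_mul,
    hp, Nat.add_sub_cancel]

lemma sum_pow_dist_self {d : ℕ} (hreg : G.IsRegularOfDegree (d + 1)) (r : ℝ) (y : V) :
    ∑ z ∈ G.neighborFinset y, r ^ G.dist y z = (d + 1) * r := by
  rw [Finset.sum_congr rfl fun z hz => by
    rw [SimpleGraph.dist_eq_one_iff_adj.2 ((G.mem_neighborFinset y z).1 hz), pow_one],
    Finset.sum_const, SimpleGraph.card_neighborFinset_eq_degree, hreg y, nsmul_eq_mul]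
  push_cast; rfl

/-- The averaging operator of simple random walk contracts the function `(2/3) ^ dist`
by the factor `17/18`, uniformly in `d ≥ 2`. -/
lemma average_pow_dist_le (hG : G.IsTree) {d : ℕ} (hd : 2 ≤ d)
    (hreg : G.IsRegularOfDegree (d + 1)) (x y : V) :
    ((d : ℝ) + 1)⁻¹ * ∑ z ∈ G.neighborFinset x, (2 / 3 : ℝ) ^ G.dist y z
      ≤ 17 / 18 * (2 / 3 : ℝ) ^ G.dist y x := by
  have hd0 : (2 : ℝ) ≤ d := by exact_mod_cast hd
  rw [inv_mul_le_iff₀ (by linarith)]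
  by_cases hxy : x = y
  · subst hxy
    rw [sum_pow_dist_self hreg, SimpleGraph.dist_self]
    linarith
  · rw [sum_pow_dist hG hreg _ hxy, dist_parent hG hxy, Nat.add_sub_cancel, pow_succ, pow_succ]
    have : (0 : ℝ) < (2 / 3) ^ G.dist y (parent hG y x) := by positivity
    nlinarith

lemma srwProb_le (hG : G.IsTree) {d : ℕ} (hd : 2 ≤ d) (hreg : G.IsRegularOfDegree (d + 1))
    (k : ℕ) (x y : V) :
    srwProb G k x y ≤ ENNReal.ofReal ((17 / 18) ^ k * (2 / 3 : ℝ) ^ G.dist y x) := by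
  induction k generalizing x with
  | zero =>
    simp only [srwProb]
    split_ifs with h
    · subst h; simp
    · exact bot_le
  | succ k ih =>
    have hdeg : (G.degree x : ℝ≥0∞)⁻¹ = ENNReal.ofReal ((d : ℝ) + 1)⁻¹ := by
      rw [hreg x, ENNReal.ofReal_inv_of_pos (by positivity)]
      congr 1
      rw [← Nat.cast_succ, ENNReal.ofReal_natCast]
    simp only [srwProb]
    rw [← Finset.mul_sum, hdeg]
    calc ENNReal.ofReal ((d : ℝ) + 1)⁻¹ * ∑ z ∈ G.neighborFinset x, srwProb G k z y
        ≤ ENNReal.ofReal ((d : ℝ) + 1)⁻¹ * ∑ z ∈ G.neighborFinset x,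
            ENNReal.ofReal ((17 / 18) ^ k * (2 / 3 : ℝ) ^ G.dist y z) := by
          gcongr with z _; exact ih z
      _ = ENNReal.ofReal ((17 / 18) ^ k * (((d : ℝ) + 1)⁻¹ *
            ∑ z ∈ G.neighborFinset x, (2 / 3 : ℝ) ^ G.dist y z)) := by
          rw [← ENNReal.ofReal_sum_of_nonneg (fun _ _ => by positivity),
            ← ENNReal.ofReal_mul (by positivity), ← Finset.mul_sum]
          congr 1; ring
      _ ≤ _ := by
          refine ENNReal.ofReal_le_ofReal ?_
          rw [pow_succ, mul_assoc]
          exact mul_le_mul_of_nonneg_left (average_pow_dist_le hG hd hreg x y) (by positivity)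

lemma tsum_srwProb_le (hG : G.IsTree) {d : ℕ} (hd : 2 ≤ d) (hreg : G.IsRegularOfDegree (d + 1))
    (x y : V) : ∑' k, srwProb G k x y ≤ ENNReal.ofReal (18 * (2 / 3 : ℝ) ^ G.dist y x) := by
  refine (ENNReal.tsum_le_tsum fun k => srwProb_le hG hd hreg k x y).trans ?_
  rw [← ENNReal.ofReal_tsum_of_nonneg (fun k => by positivity)
    ((summable_geometric_of_lt_one (by norm_num) (by norm_num)).mul_right _),
    tsum_mul_right, tsum_geometric_of_lt_one (by norm_num) (by norm_num)]
  norm_num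

open Classical in
lemma green_eq_add_average (hG : G.IsTree) {d : ℕ} (hd : 2 ≤ d)
    (hreg : G.IsRegularOfDegree (d + 1)) (x y : V) :
    green G x y = (if x = y then 1 else 0)
      + ((d : ℝ) + 1)⁻¹ * ∑ z ∈ G.neighborFinset x, green G z y := by
  have hfin : ∀ z, ∑' k, srwProb G k z y ≠ ∞ := fun z =>
    ne_top_of_le_ne_top ENNReal.ofReal_ne_top (tsum_srwProb_le hG hd hreg z y)
  have hstep : ∑' k, srwProb G k x y = (if x = y then 1 else 0)
      + (G.degree x : ℝ≥0∞)⁻¹ * ∑ z ∈ G.neighborFinset x, ∑' k, srwProb G k z y := by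
    refine (tsum_eq_zero_add' (f := fun k => srwProb G k x y) ENNReal.summable).trans ?_
    congr 1
    simp only [srwProb, ← Finset.mul_sum]
    rw [ENNReal.tsum_mul_left, Summable.tsum_finsetSum fun _ _ => ENNReal.summable]
  unfold green
  rw [hstep, ENNReal.toReal_add (by split_ifs <;> simp), ENNReal.toReal_mul,
    ENNReal.toReal_sum fun z _ => hfin z, hreg x]
  · congr 1
    · split_ifs <;> simp
    · rw [ENNReal.toReal_inv, ENNReal.toReal_natCast, Nat.cast_succ]
  · refine ENNReal.mul_ne_top ?_ (ENNReal.sum_ne_top.2 fun z _ => hfin z)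
    rw [hreg x]; simp

/-- The Green function decays exactly exponentially: both sides solve the same Poisson equation,
and their difference, a harmonic function bounded by a function that the averaging operator
contracts, vanishes. -/
lemma green_eq (hG : G.IsTree) {d : ℕ} (hd : 2 ≤ d) (hreg : G.IsRegularOfDegree (d + 1))
    (x y : V) : green G x y = (d : ℝ) / (d - 1) * (1 / (d : ℝ)) ^ G.dist y x := by
  classical
  have hd0 : (2 : ℝ) ≤ d := by exact_mod_cast hd
  have hd1 : (d : ℝ) - 1 ≠ 0 := by linarith
  have hd2 : (d : ℝ) + 1 ≠ 0 := by linarith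
  have hd3 : (d : ℝ) ≠ 0 := by linarith
  set c : ℝ := (d : ℝ) / (d - 1) with hc
  have hc0 : 0 < c := stationaryVar_pos hd
  set v : V → ℝ := fun x => c * (1 / (d : ℝ)) ^ G.dist y x with hv
  have hvp : ∀ x, v x = (if x = y then 1 else 0)
      + ((d : ℝ) + 1)⁻¹ * ∑ z ∈ G.neighborFinset x, v z := by
    intro x
    simp only [hv, ← Finset.mul_sum]
    split_ifs with hxy
    · subst hxy
      rw [sum_pow_dist_self hreg, SimpleGraph.dist_self, hc]
      field_simp
      ring
    · rw [sum_pow_dist hG hreg _ hxy, dist_parent hG hxy, Nat.add_sub_cancel]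
      simp only [pow_succ]
      generalize (1 / (d : ℝ)) ^ G.dist y (parent hG y x) = q
      field_simp
      ring
  have hharm : ∀ x, v x - green G x y
      = ((d : ℝ) + 1)⁻¹ * ∑ z ∈ G.neighborFinset x, (v z - green G z y) := by
    intro x
    rw [hvp x, green_eq_add_average hG hd hreg x y, Finset.sum_sub_distrib]
    ring
  have hbound : ∀ n x, |v x - green G x y| ≤ (c + 18) * (17 / 18) ^ n * (2 / 3) ^ G.dist y x := by
    intro n
    induction n with
    | zero =>
      intro x
      have h1 : |v x| ≤ c * (2 / 3) ^ G.dist y x := by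
        rw [abs_of_nonneg (by positivity)]
        refine mul_le_mul_of_nonneg_left (pow_le_pow_left₀ (by positivity) ?_ _) hc0.le
        rw [div_le_div_iff₀ (by linarith) (by norm_num)]
        linarith
      have h2 : |green G x y| ≤ 18 * (2 / 3) ^ G.dist y x := by
        rw [abs_of_nonneg (show 0 ≤ green G x y from ENNReal.toReal_nonneg)]
        exact ENNReal.toReal_le_of_le_ofReal (by positivity) (tsum_srwProb_le hG hd hreg x y)
      have := abs_sub (v x) (green G x y)
      rw [pow_zero, mul_one, add_mul]
      linarith
    | succ n ih =>
      intro x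
      rw [hharm x, abs_mul, abs_of_nonneg (by positivity)]
      calc ((d : ℝ) + 1)⁻¹ * |∑ z ∈ G.neighborFinset x, (v z - green G z y)|
          ≤ ((d : ℝ) + 1)⁻¹ * ∑ z ∈ G.neighborFinset x,
              ((c + 18) * (17 / 18) ^ n * (2 / 3) ^ G.dist y z) := by
            gcongr
            exact (Finset.abs_sum_le_sum_abs _ _).trans (Finset.sum_le_sum fun z _ => ih z)
        _ = (c + 18) * (17 / 18) ^ n * (((d : ℝ) + 1)⁻¹ *
              ∑ z ∈ G.neighborFinset x, (2 / 3 : ℝ) ^ G.dist y z) := by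
            rw [← Finset.mul_sum]; ring
        _ ≤ (c + 18) * (17 / 18) ^ n * (17 / 18 * (2 / 3 : ℝ) ^ G.dist y x) := by
            exact mul_le_mul_of_nonneg_left (average_pow_dist_le hG hd hreg x y) (by positivity)
        _ = _ := by ring
  have hlim : Tendsto (fun n : ℕ => (c + 18) * (17 / 18 : ℝ) ^ n * (2 / 3) ^ G.dist y x) atTop
      (𝓝 ((c + 18) * 0 * (2 / 3) ^ G.dist y x)) :=
    ((tendsto_pow_atTop_nhds_zero_of_lt_one (by norm_num) (by norm_num)).const_mul _).mul_const _
  have h0 := ge_of_tendsto' hlim fun n => hbound n x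
  rw [mul_zero, zero_mul] at h0
  have := abs_eq_zero.1 (le_antisymm h0 (abs_nonneg _))
  linarith

end Green

/-! ### The free field as a field driven by independent noise -/

section FreeField

variable {V : Type*} {G : SimpleGraph V} (hG : G.IsTree) {o : V}

/-- If `y` is not a descendant of `s`, the path from `s` to `y` starts towards the root. -/
lemma dist_eq_dist_parent_add_one {s y : V} (hs : s ≠ o)
    (hy : ∀ k, (parent hG o)^[k] y ≠ s) : G.dist y s = G.dist y (parent hG o s) + 1 := by
  classical
  have hadj := adj_parent hG hs
  have h1 : s ∉ (geodesic hG o y).support := by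
    rw [mem_support_geodesic]
    rintro ⟨k, hk⟩
    exact hy k hk
  have h2 : s ∉ (geodesic hG o (parent hG o s)).support := by
    rw [mem_support_geodesic]
    rintro ⟨k, hk⟩
    have e1 := dist_iterate_parent hG o (parent hG o s) k
    have e2 := dist_parent hG hs
    rw [hk] at e1
    omega
  -- the path from `y` to the parent of `s`, obtained by reducing the walk through the root,
  -- avoids `s`
  let q := ((geodesic hG o y).append (geodesic hG o (parent hG o s)).reverse).toPath
  have hq : s ∉ (q : G.Walk y (parent hG o s)).support := fun hsq => by
    have := SimpleGraph.Walk.support_toPath_subset_support _ hsq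
    rw [SimpleGraph.Walk.mem_support_append_iff, SimpleGraph.Walk.support_reverse,
      List.mem_reverse] at this
    exact this.elim h1 h2
  have e1 := length_geodesic hG s y
  have e2 := length_geodesic hG (parent hG o s) y
  rw [← eq_geodesic hG (q.2.concat hq hadj.symm), SimpleGraph.Walk.length_concat] at e1
  rw [← eq_geodesic hG q.2] at e2
  rw [SimpleGraph.dist_comm, ← e1, e2, SimpleGraph.dist_comm]

variable [G.LocallyFinite] {P : Measure (V → ℝ)} {d : ℕ}

lemma cov_eq (hG : G.IsTree) (hd : 2 ≤ d) (hreg : G.IsRegularOfDegree (d + 1))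
    (hP : IsGFFLaw G P) (x y : V) :
    cov[fun φ => φ x, fun φ => φ y; P] = (d : ℝ) / (d - 1) * (1 / (d : ℝ)) ^ G.dist y x := by
  have := hP.isGaussianProcess.isProbabilityMeasure
  rw [covariance_eq_sub (hP.isGaussianProcess.hasGaussianLaw_eval x).memLp_two
    (hP.isGaussianProcess.hasGaussianLaw_eval y).memLp_two, hP.mean_eq_zero, zero_mul, sub_zero,
    ← green_eq hG hd hreg, ← hP.covariance_eq]
  rfl

lemma memLp_field (hP : IsGFFLaw G P) (x : V) : MemLp (fun φ : V → ℝ => φ x) 2 P :=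
  (hP.isGaussianProcess.hasGaussianLaw_eval x).memLp_two

lemma cov_innovation_left (hP : IsGFFLaw G P) {s : V} (hs : s ≠ o) {f : (V → ℝ) → ℝ}
    (hf : MemLp f 2 P) :
    cov[fun φ => innovation hG o d φ s, f; P] = cov[fun φ => φ s, f; P]
      - 1 / (d : ℝ) * cov[fun φ => φ (parent hG o s), f; P] := by
  have := hP.isGaussianProcess.isProbabilityMeasure
  simp only [innovation_of_ne hG d _ hs]
  rw [covariance_fun_sub_left (memLp_field hP s) ((memLp_field hP _).const_mul _) hf,
    covariance_const_mul_left]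

/-- The innovation at `s` is uncorrelated with the field outside the descendants of `s`. -/
lemma cov_innovation_eq_zero (hd : 2 ≤ d) (hreg : G.IsRegularOfDegree (d + 1))
    (hP : IsGFFLaw G P) {s y : V} (hs : s ≠ o) (hy : ∀ k, (parent hG o)^[k] y ≠ s) :
    cov[fun φ => innovation hG o d φ s, fun φ => φ y; P] = 0 := by
  rw [cov_innovation_left hG hP hs (memLp_field hP y), cov_eq hG hd hreg hP,
    cov_eq hG hd hreg hP, dist_eq_dist_parent_add_one hG hs hy, pow_succ]
  ring

lemma cov_innovation_innovation (hd : 2 ≤ d) (hreg : G.IsRegularOfDegree (d + 1))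
    (hP : IsGFFLaw G P) {s t : V} (hst : s ≠ t) (hle : G.dist o t ≤ G.dist o s) :
    cov[fun φ => innovation hG o d φ s, fun φ => innovation hG o d φ t; P] = 0 := by
  have hs : s ≠ o := by
    rintro rfl
    rw [SimpleGraph.dist_self, Nat.le_zero, hG.connected.dist_eq_zero_iff] at hle
    exact hst hle
  have hpos := hG.connected.pos_dist_of_ne hs.symm
  have hnot : ∀ k, (parent hG o)^[k] t ≠ s := by
    rintro k hk
    have h1 := dist_iterate_parent hG o t k
    rw [hk] at h1
    obtain rfl : k = 0 := by omega
    exact hst hk.symm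
  by_cases ht : t = o
  · subst ht
    simp only [innovation_root]
    exact cov_innovation_eq_zero hG hd hreg hP hs hnot
  · have hm : MemLp (fun φ => innovation hG o d φ s) 2 P := by
      simp only [innovation_of_ne hG d _ hs]
      exact (memLp_field hP s).sub ((memLp_field hP _).const_mul _)
    rw [covariance_comm, cov_innovation_left hG hP ht hm, covariance_comm,
      cov_innovation_eq_zero hG hd hreg hP hs hnot, covariance_comm,
      cov_innovation_eq_zero hG hd hreg hP hs fun k => hnot (k + 1)]
    ring

lemma isGaussianProcess_innovation (hP : IsGFFLaw G P) :
    IsGaussianProcess (fun x φ => innovation hG o d φ x) P := by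
  classical
  refine hP.isGaussianProcess.of_isGaussianProcess fun s => ?_
  by_cases hs : s = o
  · subst hs
    refine ⟨{s}, ContinuousLinearMap.proj ⟨s, by simp⟩, fun φ => ?_⟩
    rw [innovation_root]; rfl
  · refine ⟨{s, parent hG o s}, ContinuousLinearMap.proj ⟨s, by simp⟩
      - (1 / (d : ℝ)) • ContinuousLinearMap.proj ⟨parent hG o s, by simp⟩, fun φ => ?_⟩
    rw [innovation_of_ne hG d _ hs]; rfl

lemma iIndepFun_innovation (hd : 2 ≤ d) (hreg : G.IsRegularOfDegree (d + 1))
    (hP : IsGFFLaw G P) : iIndepFun (fun x φ => innovation hG o d φ x) P := by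
  have h1 := IsGaussianProcess.iIndepFun_of_covariance_eq_zero (S := fun _ : V => Unit)
    (X := fun x _ φ => innovation hG o d φ x) (P := P)
    ((isGaussianProcess_innovation hG hP).comp_right Sigma.fst)
    (fun x _ => (measurable_innovation hG o d x).aemeasurable)
    (fun s t hst _ _ => by
      rcases le_total (G.dist o t) (G.dist o s) with h | h
      · exact cov_innovation_innovation hG hd hreg hP hst h
      · rw [covariance_comm]
        exact cov_innovation_innovation hG hd hreg hP hst.symm h)
  exact h1.comp (fun _ f => f ()) fun _ => measurable_pi_apply ()

lemma map_innovation_root (hd : 2 ≤ d) (hreg : G.IsRegularOfDegree (d + 1))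
    (hP : IsGFFLaw G P) : P.map (fun φ => innovation hG o d φ o) = stationaryLaw d := by
  have h := ((isGaussianProcess_innovation (o := o) (d := d) hG hP).hasGaussianLaw_eval
    o).map_eq_gaussianReal
  rw [h]
  simp only [innovation_root]
  rw [hP.mean_eq_zero, ← covariance_self (measurable_pi_apply o).aemeasurable,
    cov_eq hG hd hreg hP, SimpleGraph.dist_self, pow_zero, mul_one, stationaryLaw]

lemma map_innovation (hd : 2 ≤ d) (hreg : G.IsRegularOfDegree (d + 1))
    (hP : IsGFFLaw G P) {s : V} (hs : s ≠ o) :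
    P.map (fun φ => innovation hG o d φ s) = noiseLaw d := by
  have := hP.isGaussianProcess.isProbabilityMeasure
  have hd0 : (2 : ℝ) ≤ d := by exact_mod_cast hd
  have hd1 : (d : ℝ) - 1 ≠ 0 := by linarith
  have hd3 : (d : ℝ) ≠ 0 := by linarith
  have h := ((isGaussianProcess_innovation (o := o) (d := d) hG hP).hasGaussianLaw_eval
    s).map_eq_gaussianReal
  have hI : ∀ x, Integrable (fun φ : V → ℝ => φ x) P := fun x =>
    (memLp_field hP x).integrable one_le_two
  have hmean : ∫ φ, innovation hG o d φ s ∂P = 0 := by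
    simp only [innovation_of_ne hG d _ hs]
    rw [integral_sub (hI _) ((hI _).const_mul _), integral_const_mul, hP.mean_eq_zero,
      hP.mean_eq_zero]
    ring
  have hm : MemLp (fun φ => innovation hG o d φ s) 2 P := by
    simp only [innovation_of_ne hG d _ hs]
    exact (memLp_field hP s).sub ((memLp_field hP _).const_mul _)
  have hpar : ∀ k, (parent hG o)^[k] (parent hG o s) ≠ s := fun k hk => by
    have e1 := dist_iterate_parent hG o (parent hG o s) k
    have e2 := dist_parent hG hs
    rw [hk] at e1
    omega
  have hvar : Var[fun φ => innovation hG o d φ s; P] = ((d : ℝ) + 1) / d := by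
    rw [← covariance_self (measurable_innovation hG o d s).aemeasurable,
      cov_innovation_left hG hP hs hm, covariance_comm (fun φ : V → ℝ => φ (parent hG o s)),
      cov_innovation_eq_zero hG hd hreg hP hs hpar, covariance_comm,
      cov_innovation_left hG hP hs (memLp_field hP s), cov_eq hG hd hreg hP,
      cov_eq hG hd hreg hP, SimpleGraph.dist_self,
      SimpleGraph.dist_eq_one_iff_adj.2 (adj_parent hG hs)]
    field_simp
    ring
  rw [h, hmean, hvar, noiseLaw, ← noiseVar_coe, Real.toNNReal_coe]

open Classical in
/-- The percolation probability of the free field, by integration over its value at the root. -/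
lemma measure_infinite_cluster (hG : G.IsTree) (hd : 2 ≤ d) (hreg : G.IsRegularOfDegree (d + 1))
    (hP : IsGFFLaw G P) (h : ℝ) :
    P {φ | (cluster G o h φ).Infinite} = ∫⁻ a, ENNReal.ofReal
      (if h ≤ a then 1 - (1 - transition d (survival d h) a) ^ (d + 1) else 0)
        ∂stationaryLaw d := by
  have := hP.isGaussianProcess.isProbabilityMeasure
  set S := children hG o o with hS
  have hset : {φ : V → ℝ | (cluster G o h φ).Infinite}
      = {φ | (innovation hG o d φ o, fun v => innovation hG o d φ v) ∈
        {p : ℝ × (V → ℝ) | ∀ n, RootSurvivesTo hG o d h S n p.1 p.2}} := by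
    have := setOf_infinite_cluster_eq hG o d h (S := S) subset_rfl
    rw [subtree_children_root] at this
    simp only [inter_univ] at this
    rw [this]
    simp only [innovation_root, mem_ofPred_eq]
  have hA : MeasurableSet {p : ℝ × (V → ℝ) | ∀ n, RootSurvivesTo hG o d h S n p.1 p.2} := by
    rw [Set.ofPred_forall]
    exact MeasurableSet.iInter fun n => measurableSet_rootSurvivesTo hG o d h S n
  have key := measure_eq_lintegral_map (x := o) (measurable_innovation hG o d)
    (iIndepFun_innovation hG hd hreg hP)
    (D := ⋃ z ∈ S, descendants hG o z)
    (by simpa using fun z hz => notMem_descendants hG o hz) hA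
    (fun b y y' hyy => forall_congr' fun n => and_congr_right fun _ => exists_congr fun z =>
      and_congr_right fun hz => by
        dsimp only
        rw [hyy z (mem_biUnion hz (self_mem_descendants hG o z))]
        exact survivesTo_congr hG o fun w hw v hv =>
          hyy v (mem_biUnion hz (descendants_subset hG o hw hv)))
  rw [hset, key, map_innovation_root hG hd hreg hP]
  refine lintegral_congr fun a => ?_
  have hcard : S.card = d + 1 := by
    rw [hS, children_root, SimpleGraph.card_neighborFinset_eq_degree, hreg o]
  rw [← hcard, ← measureReal_forall_rootSurvivesTo hG (measurable_innovation hG o d)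
    (iIndepFun_innovation hG hd hreg hP) hd (fun v hv => map_innovation hG hd hreg hP hv) hreg h a
    subset_rfl, ofReal_measureReal]
  rfl

/-- The free field percolates at height `h` with positive probability if and only if the survival
probability at `h` is not identically zero. -/
lemma measure_infinite_cluster_eq_zero_iff (hG : G.IsTree) (hd : 2 ≤ d)
    (hreg : G.IsRegularOfDegree (d + 1))
    (hP : IsGFFLaw G P) (h : ℝ) :
    P {φ | (cluster G o h φ).Infinite} = 0 ↔ ∀ b, survival d h b = 0 := by
  classical
  rw [measure_infinite_cluster hG hd hreg hP]
  constructor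
  · intro h0
    have hp := (isProfile_survival d h).transition (d := d)
    have hmeas : Measurable fun a => ENNReal.ofReal
        (if h ≤ a then 1 - (1 - transition d (survival d h) a) ^ (d + 1) else 0) :=
      (Measurable.ite measurableSet_Ici
        (((hp.measurable.const_sub 1).pow_const _).const_sub 1) measurable_const).ennreal_ofReal
    rw [lintegral_eq_zero_iff hmeas] at h0
    by_contra hne
    push Not at hne
    obtain ⟨b, hb⟩ := hne
    have hb' : 0 < survival d h b :=
      lt_of_le_of_ne ((isProfile_survival d h).nonneg b) (Ne.symm hb)
    have hz : stationaryLaw d (Ici h) = 0 := by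
      refine measure_mono_null (fun a ha => ?_) (ae_iff.1 h0)
      have h1 := transition_pos hd (isProfile_survival d h) hb' a
      have h2 := pow_lt_one₀ (n := d + 1) (sub_nonneg.2 (hp.le_one a)) (by linarith) (by omega)
      simp only [mem_ofPred_eq, if_pos (mem_Ici.1 ha), Pi.zero_apply, ENNReal.ofReal_eq_zero,
        not_le]
      linarith
    have := gaussianReal_absolutelyContinuous' 0 (stationaryVar_ne_zero hd) hz
    simp at this
  · intro h0
    simp [transition_survival_eq_zero h0]

/-- Above the critical height, and at the critical height itself, there is no survival. -/
lemma survival_eq_zero_of_hStar_le (hG : G.IsTree) (hd : 2 ≤ d) (hreg : G.IsRegularOfDegree (d + 1))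
    (hP : IsGFFLaw G P) {a : ℝ} (ha : hStar G P o ≤ a) (b : ℝ) : survival d a b = 0 := by
  refine survival_eq_zero_of_forall_gt hd (fun h' hh' c => ?_) b
  have hne : {h : ℝ | P {φ | (cluster G o h φ).Infinite} = 0}.Nonempty := by
    obtain ⟨h, hh⟩ := exists_survival_eq_zero hd
    exact ⟨h, (measure_infinite_cluster_eq_zero_iff hG hd hreg hP h).2 hh⟩
  -- no lower bound on the set is needed here, since only its elements below `h'` matter
  obtain ⟨h, hh, hlt⟩ := exists_lt_of_csInf_lt hne (lt_of_le_of_lt ha hh')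
  have h0 := (measure_infinite_cluster_eq_zero_iff hG hd hreg hP h).1 hh c
  exact le_antisymm ((survival_antitone hd c hlt.le).trans h0.le)
    ((isProfile_survival d h').nonneg c)

end FreeField

end TreeGFF

end

theorem mainTheorem2 {V : Type*} (G : SimpleGraph V) [G.LocallyFinite] (d : ℕ) (hd : 2 ≤ d)
    (hG : G.IsTree) (hreg : G.IsRegularOfDegree (d + 1))
    (o obar : V) (hobar : G.Adj o obar)
    (P : Measure (V → ℝ)) (hP : TreeGFF.IsGFFLaw G P) (a : ℝ) :
    (TreeGFF.hStar G P o ≤ a →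
      Continuous (fun h => TreeGFF.eta hG d o h a) ∧
      Continuous (fun h => TreeGFF.etaPlus hG d o obar h a)) ∧
    (∀ h : ℝ, h ≠ a →
      ContinuousAt (fun h' => TreeGFF.eta hG d o h' a) h ∧
      ContinuousAt (fun h' => TreeGFF.etaPlus hG d o obar h' a) h) ∧
    (ContinuousWithinAt (fun h => TreeGFF.eta hG d o h a) (Set.Iic a) a ∧
      ContinuousWithinAt (fun h => TreeGFF.etaPlus hG d o obar h a) (Set.Iic a) a) := by
  classical
  have hk := TreeGFF.continuous_transition_survival hd a
  obtain ⟨e1, e2, e3⟩ := TreeGFF.continuity_of_eq_ite (a := a) hk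
    (η := fun h => TreeGFF.eta hG d o h a) fun h => by
      have := TreeGFF.condLaw_real_infinite_cluster hG o hd hreg h a
        (S := TreeGFF.children hG o o) subset_rfl
      simp only [TreeGFF.subtree_children_root, Set.inter_univ] at this
      exact this
  obtain ⟨p1, p2, p3⟩ := TreeGFF.continuity_of_eq_ite (a := a) hk
    (η := fun h => TreeGFF.etaPlus hG d o obar h a) fun h => by
      have := TreeGFF.condLaw_real_infinite_cluster hG o hd hreg h a
        (S := (TreeGFF.children hG o o).erase obar) (Finset.erase_subset _ _)
      rw [TreeGFF.subtree_erase hG o hobar] at this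
      exact this
  refine ⟨fun ha => ?_, fun h hh => ⟨e2 h hh, p2 h hh⟩, e3, p3⟩
  have h0 := TreeGFF.transition_survival_eq_zero
    (TreeGFF.survival_eq_zero_of_hStar_le hG hd hreg hP ha) a
  exact ⟨e1 h0, p1 h0⟩
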